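/- Let $G$ be a finite group. Write $[x,y]=xyx^{-1}y^{-1}$, $\{x,y\}=xyx^{-1}y$, $y^x=xyx^{-1}$ for $x,y\in G$, and let $S(G)=\langle x^2 : x\in G\rangle$. Let $(G,G)$ be the free group on symbols $\langle x,y\rangle$, $(x,y)$ and $(z)$, with $x,y,z\in G$, and let $(G,G)\to S(G)$ be the homomorphism with $\langle x,y\rangle\mapsto[x,y]$, $(x,y)\mapsto\{x,y\}$, $(z)\mapsto z^2$. The unoriented Schur multiplier is $$\mathcal M(G;\mathbb Z_2)=\ker\big((G,G)\to S(G)\big)/N,$$ where $N$ is the normal subgroup of $(G,G)$ generated by the relations, for $x,y,z\in G$ and $i,j\in\mathbb Z$ (with $\langle y,z\rangle^x=\langle y^x,z^x\rangle$ and $(y,z)^x=(y^x,z^x)$), $$(x^i)(x^j)\sim(x^{i+j}),\quad (x,xy)\sim(x)(y),\quad \langle x,y\rangle\sim(x)(x^{-1}y)(y^{-1}),\quad \langle xy,z\rangle\sim(y,z)^x(x,z^{-1}),$$ $$\langle y,z\rangle^x\sim\langle x,[y,z]\rangle\langle y,z\rangle,\quad (y,z)^x\sim\langle x,\{y,z\}\rangle(y,z),\quad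 (y^x,z^x)^{-1}\sim(x,\{y,z\}^{-1})(y,z).$$ The unoriented Bogomolov multiplier $B_0(G;\mathbb Z_2)$ is the quotient of $\mathcal M(G;\mathbb Z_2)$ by the subgroup generated by the classes of $\langle x,y\rangle$ with $[x,y]=1$, of $(x,y)$ with $\{x,y\}=1$, and of $(z)$ with $z^2=1$. Let $\Gamma_1$ be the set of subgroups $A\le G$ with $a^2=1$ for all $a\in A$. Let $\Gamma_2$ be the set of subgroups of $G$ generated by two elements $a,b$ satisfying $ab=ba$ or $ab=b^{-1}a$. Then there is an isomorphism of groups $$B_0(G;\mathbb Z_2)\;\cong\bigcap_{A\in\Gamma_1\cup\Gamma_2}\ker\big(\operatorname{res}\colon H^2(G;\mathbb Z_2)\to H^2(A;\mathbb Z_2)\big),$$ where $H^2$ is group cohomology with trivial coefficients $\mathbb Z_2$. -/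

import Mathlib

namespace UnorientedBogomolov

universe u

section Multiplier

variable (G : Type u) [Group G]

/-- The subgroup `S(G)` generated by the squares of elements of `G`. -/
def squares : Subgroup G := Subgroup.closure (Set.range fun x : G => x ^ 2)

/-- The free generators of the group `(G, G)`: oriented pairs `⟨x, y⟩`, unoriented pairs
`(x, y)` and square elements `(z)`. -/
inductive Gen : Type u
  | oriented (x y : G) : Gen
  | unoriented (x y : G) : Gen
  | square (z : G) : Gen

variable {G}

/-- The commutator `[x, y] = x y x⁻¹ y⁻¹`. -/
def comm (x y : G) : G := x * y * x⁻¹ * y⁻¹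

/-- The unoriented commutator `{x, y} = x y x⁻¹ y`. -/
def ucomm (x y : G) : G := x * y * x⁻¹ * y

/-- The conjugate `y ^ x = x y x⁻¹`. -/
def cj (y x : G) : G := x * y * x⁻¹

/-- The element `⟨x, y⟩` of the free group `(G, G)`. -/
def op (x y : G) : FreeGroup (Gen G) := FreeGroup.of (Gen.oriented x y)

/-- The element `(x, y)` of the free group `(G, G)`. -/
def up (x y : G) : FreeGroup (Gen G) := FreeGroup.of (Gen.unoriented x y)

/-- The element `(z)` of the free group `(G, G)`. -/
def sq (z : G) : FreeGroup (Gen G) := FreeGroup.of (Gen.square z)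

lemma sq_mem_squares (x : G) : x ^ 2 ∈ squares G := Subgroup.subset_closure ⟨x, rfl⟩

lemma ucomm_mem_squares (x y : G) : ucomm x y ∈ squares G := by
  have h : ucomm x y = x ^ 2 * (x⁻¹ * y) ^ 2 := by simp only [ucomm, pow_two]; group
  rw [h]
  exact mul_mem (sq_mem_squares _) (sq_mem_squares _)

lemma comm_mem_squares (x y : G) : comm x y ∈ squares G := by
  have h : comm x y = ucomm x y * (y⁻¹) ^ 2 := by simp only [comm, ucomm, pow_two]; group
  rw [h]
  exact mul_mem (ucomm_mem_squares _ _) (sq_mem_squares _)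

/-- The values of the canonical map on the free generators. -/
def genValue : Gen G → squares G
  | Gen.oriented x y => ⟨comm x y, comm_mem_squares x y⟩
  | Gen.unoriented x y => ⟨ucomm x y, ucomm_mem_squares x y⟩
  | Gen.square z => ⟨z ^ 2, sq_mem_squares z⟩

variable (G) in
/-- The canonical map `(G, G) → S(G)`, sending `⟨x, y⟩` to `[x, y]`, `(x, y)` to `{x, y}` and
`(z)` to `z²`. -/
def canonicalMap : FreeGroup (Gen G) →* squares G := FreeGroup.lift genValue

/-- The seven defining relations `u ∼ v` between elements of `(G, G)`. Exponents on symbols denote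
conjugation of all entries: `⟨y, z⟩ ^ x = ⟨y ^ x, z ^ x⟩` and `(y, z) ^ x = (y ^ x, z ^ x)`. -/
inductive Rel : FreeGroup (Gen G) → FreeGroup (Gen G) → Prop
  | powers (x : G) (i j : ℤ) : Rel (sq (x ^ i) * sq (x ^ j)) (sq (x ^ (i + j)))
  | unoriented_mul (x y : G) : Rel (up x (x * y)) (sq x * sq y)
  | oriented_eq (x y : G) : Rel (op x y) (sq x * sq (x⁻¹ * y) * sq y⁻¹)
  | mul_left (x y z : G) : Rel (op (x * y) z) (up (cj y x) (cj z x) * up x z⁻¹)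
  | oriented_conj (x y z : G) : Rel (op (cj y x) (cj z x)) (op x (comm y z) * op y z)
  | unoriented_conj (x y z : G) : Rel (up (cj y x) (cj z x)) (op x (ucomm y z) * up y z)
  | unoriented_inv (x y z : G) :
      Rel (up (cj y x) (cj z x))⁻¹ (up x (ucomm y z)⁻¹ * up y z)

variable (G) in
/-- The normal subgroup of `(G, G)` generated by the seven relations. -/
def relSubgroup : Subgroup (FreeGroup (Gen G)) :=
  Subgroup.normalClosure {w | ∃ u v, Rel u v ∧ w = u * v⁻¹}

instance : (relSubgroup G).Normal := Subgroup.normalClosure_normal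

lemma relSubgroup_le_ker : relSubgroup G ≤ (canonicalMap G).ker := by
  refine Subgroup.normalClosure_le_normal ?_
  rintro w ⟨u, v, h, rfl⟩
  rw [SetLike.mem_coe, MonoidHom.mem_ker, map_mul, map_inv, mul_inv_eq_one]
  apply Subtype.ext
  cases h <;>
    simp [canonicalMap, op, up, sq, genValue, comm, ucomm, cj, pow_two, mul_assoc, zpow_add]
  rename_i x i j
  simp only [← zpow_add]
  congr 1
  ring

variable (G) in
/-- The unoriented Schur multiplier `M(G; ℤ₂)`: the kernel of `(G, G) → S(G)` modulo the normal
subgroup generated by the seven relations (which lies in this kernel). -/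
abbrev SchurMultiplier : Type u :=
  (canonicalMap G).ker ⧸ (relSubgroup G).subgroupOf (canonicalMap G).ker

variable (G) in
/-- The subgroup of `M(G; ℤ₂)` generated by the classes over the torus `⟨x, y⟩` with `[x, y] = 1`,
the Klein bottle `(x, y)` with `{x, y} = 1`, and the projective plane `(z)` with `z² = 1`. -/
def extendableSubgroup : Subgroup (SchurMultiplier G) :=
  Subgroup.closure {m | ∃ w : (canonicalMap G).ker, m = QuotientGroup.mk w ∧
    ((∃ x y : G, comm x y = 1 ∧ (w : FreeGroup (Gen G)) = op x y) ∨
     (∃ x y : G, ucomm x y = 1 ∧ (w : FreeGroup (Gen G)) = up x y) ∨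
     (∃ z : G, z ^ 2 = 1 ∧ (w : FreeGroup (Gen G)) = sq z))}

/-! The subgroup above is normal, because `M(G; ℤ₂)` is commutative. -/

/-- The projection of `(G, G)` onto its quotient by the relations. -/
def pr : FreeGroup (Gen G) →* FreeGroup (Gen G) ⧸ relSubgroup G :=
  QuotientGroup.mk' (relSubgroup G)

lemma pr_eq {u v : FreeGroup (Gen G)} (h : Rel u v) : pr u = pr v := by
  rw [← mul_inv_eq_one, ← map_inv, ← map_mul]
  exact (QuotientGroup.eq_one_iff (N := relSubgroup G) _).2 (Subgroup.subset_normalClosure ⟨u, v, h, rfl⟩)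

lemma pr_sq_one : pr (sq (1 : G)) = 1 := by
  have h := pr_eq (Rel.powers (1 : G) 0 0)
  simpa using h

lemma pr_sq_inv (x : G) : pr (sq x⁻¹) = (pr (sq x))⁻¹ := by
  have h := pr_eq (Rel.powers x (-1) 1)
  rw [map_mul] at h
  simp only [zpow_neg, zpow_one, neg_add_cancel, zpow_zero, pr_sq_one] at h
  exact eq_inv_of_mul_eq_one_left h

lemma pr_up (x y : G) : pr (up x y) = pr (sq x) * pr (sq (x⁻¹ * y)) := by
  have h := pr_eq (Rel.unoriented_mul x (x⁻¹ * y))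
  rwa [mul_inv_cancel_left, map_mul] at h

lemma pr_op (x y : G) :
    pr (op x y) = pr (sq x) * pr (sq (x⁻¹ * y)) * (pr (sq y))⁻¹ := by
  rw [pr_eq (Rel.oriented_eq x y), map_mul, map_mul, pr_sq_inv]

lemma pr_up' (x y : G) : pr (up x y) = pr (op x y) * pr (sq y) := by
  rw [pr_up, pr_op]; group

lemma pr_op_self (x : G) : pr (op x x) = 1 := by
  rw [pr_op]; simp [pr_sq_one]

lemma pr_op_swap (x y : G) : pr (op x y) = (pr (op y x))⁻¹ := by
  rw [pr_op, pr_op, show x⁻¹ * y = (y⁻¹ * x)⁻¹ by group, pr_sq_inv]; group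

lemma pr_op_mul_left (x y z : G) :
    pr (op (x * y) z) = pr (op (cj y x) (cj z x)) * pr (op x z) := by
  have key (y : G) : pr (op (x * y) z) = pr (op (cj y x) (cj z x)) * (pr (sq (cj z x)) *
      pr (up x z⁻¹)) := by
    rw [pr_eq (Rel.mul_left x y z), map_mul, pr_up' (cj y x)]; group
  have h1 := key 1
  have h2 : pr (op (cj 1 x) (cj z x)) = 1 := by
    rw [pr_op]; simp [cj, pr_sq_one]
  rw [h2, one_mul, mul_one] at h1
  rw [key, h1]

lemma pr_op_mul_right (x y z : G) :
    pr (op x (y * z)) = pr (op x y) * pr (op (cj x y) (cj z y)) := by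
  rw [pr_op_swap, pr_op_mul_left, mul_inv_rev, ← pr_op_swap, ← pr_op_swap]

lemma pr_sq_cj (x z : G) : pr (sq (cj z x)) = pr (op x (z * z)) * pr (sq z) := by
  have h := pr_eq (Rel.unoriented_conj x 1 z)
  rw [map_mul, pr_up, pr_up] at h
  simpa [cj, ucomm, pr_sq_one] using h

lemma pr_sq_conj (x y : G) :
    pr (sq x) * pr (sq y) * (pr (sq x))⁻¹ = pr (sq (x ^ 2 * y * (x ^ 2)⁻¹)) := by
  have e : x ^ 2 * y * (x ^ 2)⁻¹ = cj (cj y x) x := by simp only [cj, pow_two]; group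
  have h1 : pr (sq x) * pr (sq y) = pr (op x (x * y)) * pr (sq (x * y)) := by
    rw [pr_op]; simp
  have h2 : pr (sq (x * y)) * (pr (sq x))⁻¹ =
      pr (op (x * y) (cj y x)) * pr (sq (cj y x)) := by
    rw [← pr_sq_inv, pr_op]
    have : (x * y)⁻¹ * cj y x = x⁻¹ := by simp only [cj]; group
    rw [this]; group
  have h3 : pr (op x (x * y)) = pr (op x (cj y x)) := by
    rw [pr_op_mul_right, pr_op_self, one_mul]
    congr 2; simp only [cj]; group
  have h4 : pr (op (x * y) (cj y x)) = pr (op (cj x (cj y x)) (cj (cj y x) (cj y x))) := by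
    have : x * y = cj y x * x := by simp only [cj]; group
    rw [this, pr_op_mul_left, pr_op_self, mul_one]
  rw [e, pr_sq_cj, pr_op_mul_right, h1, mul_assoc, h2, h3, h4, mul_assoc]

lemma pr_conj_sq (w : FreeGroup (Gen G)) (y : G) :
    pr w * pr (sq y) * (pr w)⁻¹ =
      pr (sq ((canonicalMap G w : G) * y * (canonicalMap G w : G)⁻¹)) := by
  have hmul : ∀ a b : FreeGroup (Gen G) ⧸ relSubgroup G, ∀ g h : G,
      (∀ y, a * pr (sq y) * a⁻¹ = pr (sq (g * y * g⁻¹))) →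
      (∀ y, b * pr (sq y) * b⁻¹ = pr (sq (h * y * h⁻¹))) →
      ∀ y, (a * b) * pr (sq y) * (a * b)⁻¹ = pr (sq ((g * h) * y * (g * h)⁻¹)) := by
    intro a b g h ha hb y
    rw [show (a * b) * pr (sq y) * (a * b)⁻¹ = a * (b * pr (sq y) * b⁻¹) * a⁻¹ by group,
      hb, ha]
    congr 2; group
  have hinv : ∀ a : FreeGroup (Gen G) ⧸ relSubgroup G, ∀ g : G,
      (∀ y, a * pr (sq y) * a⁻¹ = pr (sq (g * y * g⁻¹))) →
      ∀ y, a⁻¹ * pr (sq y) * a⁻¹⁻¹ = pr (sq (g⁻¹ * y * g⁻¹⁻¹)) := by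
    intro a g ha y
    have h := ha (g⁻¹ * y * g)
    rw [show g * (g⁻¹ * y * g) * g⁻¹ = y by group] at h
    rw [← h, inv_inv g]; group
  induction w using FreeGroup.induction_on generalizing y with
  | C1 => simp
  | of x =>
    rcases x with ⟨a, b⟩ | ⟨a, b⟩ | z
    · have h := hmul _ _ _ _ (hmul _ _ _ _ (pr_sq_conj a) (pr_sq_conj (a⁻¹ * b)))
        (hinv _ _ (pr_sq_conj b)) y
      rw [← pr_op] at h
      refine h.trans ?_
      have e : a ^ 2 * (a⁻¹ * b) ^ 2 * (b ^ 2)⁻¹ = comm a b := by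
        simp only [comm, pow_two]; group
      rw [e]
      simp [canonicalMap, genValue]
    · have h := hmul _ _ _ _ (pr_sq_conj a) (pr_sq_conj (a⁻¹ * b)) y
      rw [← pr_up] at h
      refine h.trans ?_
      have e : a ^ 2 * (a⁻¹ * b) ^ 2 = ucomm a b := by
        simp only [ucomm, pow_two]; group
      rw [e]
      simp [canonicalMap, genValue]
    · refine (pr_sq_conj z y).trans ?_
      simp [canonicalMap, genValue]
  | inv_of x hx =>
    rw [map_inv, map_inv, Subgroup.coe_inv]
    exact hinv _ _ (fun y => hx y) y
  | mul a b ha hb =>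
    rw [map_mul, map_mul, Subgroup.coe_mul]
    exact hmul _ _ _ _ ha hb y

lemma pr_commute (w v : FreeGroup (Gen G)) (hw : w ∈ (canonicalMap G).ker) :
    Commute (pr w) (pr v) := by
  have h (y : G) : Commute (pr w) (pr (sq y)) := by
    have h := pr_conj_sq w y
    rw [MonoidHom.mem_ker.1 hw] at h
    have h' : pr w * pr (sq y) * (pr w)⁻¹ = pr (sq y) := by simpa using h
    exact mul_inv_eq_iff_eq_mul.1 h'
  induction v using FreeGroup.induction_on with
  | C1 => simp
  | of x =>
    rcases x with ⟨a, b⟩ | ⟨a, b⟩ | z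
    · exact (congrArg (Commute (pr w)) (pr_op a b)).mpr
        (((h a).mul_right (h _)).mul_right (h b).inv_right)
    · exact (congrArg (Commute (pr w)) (pr_up a b)).mpr ((h a).mul_right (h _))
    · exact h z
  | inv_of x hx => rw [map_inv]; exact hx.inv_right
  | mul a b ha hb => rw [map_mul]; exact ha.mul_right hb

/-- `M(G; ℤ₂)` is commutative. -/
lemma schurMultiplier_mul_comm (a b : SchurMultiplier G) : a * b = b * a := by
  induction a using QuotientGroup.induction_on with
  | H a =>
  induction b using QuotientGroup.induction_on with
  | H b =>
  rw [← QuotientGroup.mk_mul, ← QuotientGroup.mk_mul, QuotientGroup.eq,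
    Subgroup.mem_subgroupOf]
  have h : pr ((a : FreeGroup (Gen G)) * (b : FreeGroup (Gen G))) =
      pr ((b : FreeGroup (Gen G)) * (a : FreeGroup (Gen G))) := by
    rw [map_mul, map_mul]; exact pr_commute _ _ a.2
  simpa using QuotientGroup.eq.1 h

instance : (extendableSubgroup G).Normal where
  conj_mem n hn g := by rwa [schurMultiplier_mul_comm g n, mul_inv_cancel_right]

variable (G) in
/-- The unoriented Bogomolov multiplier `B₀(G; ℤ₂)`. -/
abbrev BogomolovMultiplier : Type u := SchurMultiplier G ⧸ extendableSubgroup G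

end Multiplier

section Cohomology

/-- The field `ℤ₂` with two elements, placed in the universe of the group. -/
abbrev F2 : Type u := ULift.{u} (ZMod 2)

/-- `H²(G; ℤ₂)`, with trivial action of `G` on `ℤ₂`. -/
noncomputable abbrev H2 (G : Type u) [Group G] : ModuleCat.{u} F2.{u} :=
  groupCohomology (Rep.trivial F2.{u} G F2.{u}) 2

variable {G : Type u} [Group G]

/-- The restriction map `H²(G; ℤ₂) → H²(A; ℤ₂)` to a subgroup `A`. -/
noncomputable def restriction (A : Subgroup G) : H2 G →ₗ[F2.{u}] H2 A :=
  (groupCohomology.map (A := Rep.trivial F2.{u} G F2.{u}) (B := Rep.trivial F2.{u} A F2.{u})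
    A.subtype (CategoryTheory.CategoryStruct.id (Rep.trivial F2.{u} A F2.{u})) 2).hom

variable (G)

/-- `Γ₁`: the subgroups all of whose elements satisfy `x² = 1`. -/
def Γ₁ : Set (Subgroup G) := {A | ∀ x ∈ A, x ^ 2 = 1}

/-- `Γ₂`: the subgroups generated by two elements `a`, `b` that commute (for finite `G`: the
products of two cyclic groups) or that satisfy the Klein bottle relation `a b = b⁻¹ a`. -/
def Γ₂ : Set (Subgroup G) :=
  {A | ∃ a b : G, A = Subgroup.closure {a, b} ∧ (a * b = b * a ∨ a * b = b⁻¹ * a)}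

end Cohomology

end UnorientedBogomolov

/-! Let R be (G, G)/N. It is generated by the classes (x), and its relations make (x) behave like
the square of a lift of x. The map R → G has image S(G) and central kernel M = 𝓜(G; ℤ₂). For finite
G, `SqExtension.exists_surjective` enlarges R to a group E that maps onto G with the same kernel M,
and in which the square of every lift of x is (x). Hence M is central of exponent 2 and lies in the
subgroup generated by the squares of E.

Transgression sends a character φ : M → ℤ₂ to the class of φ applied to a factor set of E. A
character of a subgroup extends to the whole group once it is trivial on products of squares
(`exists_extension_of_squares`). So the restriction of the transgression to A vanishes exactly when
φ kills those products of squares of elements over A that lie in M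
(`restriction_transgression_eq_zero_iff_squares`). For A = G this gives injectivity. For
surjectivity, inflate a cocycle of G to a central extension D of E by ℤ₂. By
`exists_lift_of_central` the subgroup generated by the squares of D is a copy of R, so it meets the
new ℤ₂ trivially, and the character of ℤ₂ extends to D. Thus Hom(M, ℤ₂) ≅ H²(G; ℤ₂).

Over a group in Γ₁ or Γ₂, a product of squares reduces to a single square or a single Klein bottle
word (`eq_one_of_mem_squares`). Therefore the transgression of φ dies on all these groups exactly
when φ kills the extendable classes, that is, when φ is a character of B₀. Finally B₀ is an
elementary abelian 2-group with finitely many characters, hence (non-canonically) isomorphic to its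
character group. -/

namespace UnorientedBogomolov

universe u

/-! ### The quotient (G, G)/N, its generators and the action of G -/

section Quotient

variable {G : Type u} [Group G]

variable (G) in
/-- The quotient of `(G, G)` by the relations. -/
abbrev RelQuotient : Type u := FreeGroup (Gen G) ⧸ relSubgroup G

/-- The class of `(x)`. -/
def sqClass (x : G) : RelQuotient G := pr (sq x)

/-- The class of `⟨x, y⟩`. -/
def opClass (x y : G) : RelQuotient G := pr (op x y)

variable (G) in
/-- The map induced by the canonical map `(G, G) → S(G)`, with values in `G`. -/
def RelQuotient.value : RelQuotient G →* G :=
  QuotientGroup.lift (relSubgroup G) ((squares G).subtype.comp (canonicalMap G)) fun w hw => by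
    simp [MonoidHom.mem_ker.1 (relSubgroup_le_ker hw)]

open RelQuotient

lemma value_pr (w : FreeGroup (Gen G)) : value G (pr w) = canonicalMap G w := rfl

@[simp]
lemma value_sqClass (x : G) : value G (sqClass x) = x ^ 2 := by
  simp [sqClass, value_pr, canonicalMap, sq, genValue]

@[simp]
lemma value_opClass (x y : G) : value G (opClass x y) = x * y * x⁻¹ * y⁻¹ := by
  simp [opClass, value_pr, canonicalMap, op, genValue, comm]

lemma opClass_eq (x y : G) :
    opClass x y = sqClass x * sqClass (x⁻¹ * y) * (sqClass y)⁻¹ := pr_op x y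

lemma sqClass_inv (x : G) : sqClass x⁻¹ = (sqClass x)⁻¹ := pr_sq_inv x

@[simp]
lemma sqClass_one : sqClass (1 : G) = 1 := pr_sq_one

lemma sqClass_mul_self (x : G) : sqClass x * sqClass x = sqClass (x ^ 2) := by
  have h := pr_eq (Rel.powers x 1 1)
  rw [map_mul, zpow_one, show (1 + 1 : ℤ) = (2 : ℕ) from rfl, zpow_natCast] at h
  exact h

-- The classes (x) generate already as a monoid: the other two kinds of symbol are words in them,
-- and (x)⁻¹ = (x⁻¹).
@[elab_as_elim]
lemma RelQuotient.induction {p : RelQuotient G → Prop} (q : RelQuotient G)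
    (h : ∀ x, p (sqClass x)) (hmul : ∀ a b, p a → p b → p (a * b)) : p q := by
  have hgen (x : Gen G) : p (pr (FreeGroup.of x)) ∧ p (pr (FreeGroup.of x))⁻¹ := by
    have hi (x : G) : p (sqClass x)⁻¹ := sqClass_inv x ▸ h x⁻¹
    rcases x with ⟨x, y⟩ | ⟨x, y⟩ | z
    · have e : pr (FreeGroup.of (Gen.oriented x y)) =
          sqClass x * sqClass (x⁻¹ * y) * (sqClass y)⁻¹ := pr_op x y
      rw [e, mul_inv_rev, mul_inv_rev, inv_inv]
      exact ⟨hmul _ _ (hmul _ _ (h _) (h _)) (hi _), hmul _ _ (h _) (hmul _ _ (hi _) (hi _))⟩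
    · have e : pr (FreeGroup.of (Gen.unoriented x y)) =
          sqClass x * sqClass (x⁻¹ * y) := pr_up x y
      rw [e, mul_inv_rev]
      exact ⟨hmul _ _ (h _) (h _), hmul _ _ (hi _) (hi _)⟩
    · exact ⟨h z, hi z⟩
  obtain ⟨w, rfl⟩ := QuotientGroup.mk'_surjective (relSubgroup G) q
  change p (pr w)
  induction w using FreeGroup.induction_on with
  | C1 => rw [map_one]; exact sqClass_one (G := G) ▸ h 1
  | of x => exact (hgen x).1
  | inv_of x _ => rw [map_inv]; exact (hgen x).2
  | mul a b ha hb => rw [map_mul]; exact hmul _ _ ha hb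

lemma RelQuotient.hom_ext {H : Type*} [Monoid H] {f g : RelQuotient G →* H}
    (h : ∀ x, f (sqClass x) = g (sqClass x)) : f = g := by
  refine MonoidHom.ext fun q => ?_
  induction q using RelQuotient.induction with
  | h x => exact h x
  | hmul a b ha hb => rw [map_mul, map_mul, ha, hb]

/-- Functoriality of the generators. -/
def Gen.map {H : Type u} (f : G → H) : Gen G → Gen H
  | Gen.oriented x y => Gen.oriented (f x) (f y)
  | Gen.unoriented x y => Gen.unoriented (f x) (f y)
  | Gen.square z => Gen.square (f z)

lemma Rel.map {H : Type u} [Group H] (f : G →* H) {u v : FreeGroup (Gen G)} (h : Rel u v) :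
    Rel (FreeGroup.map (Gen.map f) u) (FreeGroup.map (Gen.map f) v) := by
  cases h
  · simpa [sq, Gen.map] using Rel.powers (f _) _ _
  · simpa [sq, up, Gen.map] using Rel.unoriented_mul (f _) (f _)
  · simpa [sq, op, Gen.map] using Rel.oriented_eq (f _) (f _)
  · simpa [up, op, Gen.map, cj] using Rel.mul_left (f _) (f _) (f _)
  · simpa [up, op, Gen.map, cj, comm] using Rel.oriented_conj (f _) (f _) (f _)
  · simpa [up, op, Gen.map, cj, ucomm] using Rel.unoriented_conj (f _) (f _) (f _)
  · simpa [up, op, Gen.map, cj, ucomm] using Rel.unoriented_inv (f _) (f _) (f _)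

/-- The action of `G` on the quotient of `(G, G)` by conjugation of all entries. -/
def conjAct (g : G) : RelQuotient G →* RelQuotient G :=
  QuotientGroup.map _ _ (FreeGroup.map (Gen.map (MulAut.conj g).toMonoidHom)) <| by
    refine Subgroup.normalClosure_le_normal ?_
    rintro w ⟨u, v, h, rfl⟩
    exact Subgroup.subset_normalClosure ⟨_, _, h.map (MulAut.conj g).toMonoidHom, by simp⟩

@[simp]
lemma conjAct_sqClass (g x : G) : conjAct g (sqClass x) = sqClass (g * x * g⁻¹) := rfl

lemma conjAct_mul (g h : G) (q : RelQuotient G) :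
    conjAct (g * h) q = conjAct g (conjAct h q) := by
  have : conjAct (g * h) = (conjAct g).comp (conjAct h) :=
    RelQuotient.hom_ext fun x => by simp [mul_assoc]
  rw [this, MonoidHom.comp_apply]

/-- Both sides are homomorphisms in `r`, so generators suffice, where this is `pr_conj_sq`. Together
with `value` the action makes (G, G)/N a crossed module over G. -/
lemma conj_eq_conjAct (q r : RelQuotient G) : q * r * q⁻¹ = conjAct (value G q) r := by
  have : (MulAut.conj q).toMonoidHom = conjAct (value G q) := by
    refine RelQuotient.hom_ext fun x => ?_
    obtain ⟨w, rfl⟩ := QuotientGroup.mk'_surjective (relSubgroup G) q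
    exact pr_conj_sq w x
  exact DFunLike.congr_fun this r

lemma opClass_one_right (x : G) : opClass x 1 = 1 := by
  simp [opClass_eq, sqClass_inv]

lemma opClass_one_left (x : G) : opClass 1 x = 1 := by
  simp [opClass_eq]

lemma opClass_mul_right (x y z : G) :
    opClass x (y * z) = opClass x y * conjAct y (opClass x z) := pr_op_mul_right x y z

lemma opClass_mul_left (x y z : G) :
    opClass (x * y) z = conjAct x (opClass y z) * opClass x z := pr_op_mul_left x y z

lemma opClass_swap (x y : G) : opClass x y = (opClass y x)⁻¹ := pr_op_swap x y

/-- On a generator this is the relation for (z) conjugated by g; it spreads to products because the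
pairing is a crossed homomorphism in its second entry. -/
lemma conjAct_eq (g : G) (q : RelQuotient G) :
    conjAct g q = opClass g (value G q) * q := by
  induction q using RelQuotient.induction with
  | h x => rw [conjAct_sqClass, value_sqClass, pow_two]; exact pr_sq_cj g x
  | hmul a b ha hb =>
    rw [map_mul, ha, hb, map_mul, opClass_mul_right, ← conj_eq_conjAct]
    group

/-- Mirrors the identity (xy)² = [x, y] · (y x² y⁻¹) · y², and is what carries the rule for squares
from two factors to their product. -/
lemma sqClass_mul (x y : G) :
    opClass x y * conjAct y (sqClass x) * sqClass y = sqClass (x * y) := by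
  have h1 : conjAct x (opClass y x) * sqClass x * sqClass y = sqClass (x * y) := by
    have h := opClass_mul_right x x y
    rw [opClass_eq, opClass_eq x x] at h
    simp only [inv_mul_cancel_left, inv_mul_cancel, sqClass_one, mul_one, mul_inv_cancel,
      one_mul] at h
    rw [opClass_swap y x, map_inv, ← h]
    group
  rw [conjAct_eq, value_sqClass, pow_two, opClass_mul_right, opClass_swap x y, ← h1]
  group

end Quotient

open RelQuotient

/-! ### Enlarging (G, G)/N to a central extension of G -/

section Extension

variable (G : Type u) [Group G]

/-- A central extension of a subgroup of `G` by the kernel of `(G, G)/N → S(G)`, containing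
`(G, G)/N` and in which the square of a lift of `x` is the class of `(x)`. -/
structure SqExtension where
  /-- The underlying group. -/
  E : Type u
  [group : Group E]
  /-- The embedding of the quotient of `(G, G)`. -/
  ι : RelQuotient G →* E
  /-- The projection to `G`. -/
  π : E →* G
  ι_injective : Function.Injective ι
  π_ι : ∀ q, π (ι q) = value G q
  ker_π : ∀ y, π y = 1 → y ∈ ι.range
  conj_ι : ∀ y q, y * ι q * y⁻¹ = ι (conjAct (π y) q)
  sq_eq : ∀ y, y ^ 2 = ι (sqClass (π y))

attribute [instance] SqExtension.group

variable {G}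

/-- Squares of products in a group with the action of lifts on `(G, G)/N` by conjugation. -/
lemma sq_mul_eq {E : Type*} [Group E] (ι : RelQuotient G →* E) (π : E →* G)
    (hc : ∀ y q, y * ι q * y⁻¹ = ι (conjAct (π y) q)) {x y : E}
    (hx : x ^ 2 = ι (sqClass (π x))) (hy : y ^ 2 = ι (sqClass (π y)))
    (hxy : x * y * x⁻¹ = ι (opClass (π x) (π y)) * y) :
    (x * y) ^ 2 = ι (sqClass (π (x * y))) := by
  rw [map_mul, ← sqClass_mul, map_mul, map_mul, ← hy, ← hc, ← hx,
    show (x * y) ^ 2 = (x * y * x⁻¹) * x ^ 2 * y by simp only [pow_two]; group, hxy]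
  simp only [pow_two]; group

variable (G) in
/-- The quotient of `(G, G)` as an extension of `S(G)`. -/
def SqExtension.base : SqExtension G where
  E := RelQuotient G
  ι := MonoidHom.id _
  π := value G
  ι_injective := Function.injective_id
  π_ι _ := rfl
  ker_π y _ := ⟨y, rfl⟩
  conj_ι := conj_eq_conjAct
  sq_eq y := by
    induction y using RelQuotient.induction with
    | h x => rw [pow_two, sqClass_mul_self, value_sqClass]; rfl
    | hmul a b ha hb =>
      exact sq_mul_eq (MonoidHom.id _) (value G) conj_eq_conjAct ha hb
        ((conj_eq_conjAct a b).trans (conjAct_eq _ _))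

namespace SqExtension

variable (X : SqExtension G)

attribute [simp] SqExtension.π_ι

lemma comm_eq (x y : X.E) : x * y * x⁻¹ * y⁻¹ = X.ι (opClass (X.π x) (X.π y)) := by
  have h : x * y * x⁻¹ * y⁻¹ = x ^ 2 * (x⁻¹ * y) ^ 2 * (y ^ 2)⁻¹ := by
    simp only [pow_two]; group
  rw [h, X.sq_eq, X.sq_eq, X.sq_eq, opClass_eq]
  simp

/-- The action of `G` on an extension. -/
def act (k : G) : X.E →* X.E where
  -- If k had a lift x, conjugation by x would multiply y by [x, y], which depends only on k and `π
  -- y`. The formula makes sense without a lift.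
  toFun y := X.ι (opClass k (X.π y)) * y
  map_one' := by simp [opClass_one_right]
  map_mul' y z := by
    rw [map_mul, opClass_mul_right, map_mul, ← X.conj_ι]; group

lemma act_apply (k : G) (y : X.E) : X.act k y = X.ι (opClass k (X.π y)) * y := rfl

lemma act_ι (k : G) (q : RelQuotient G) : X.act k (X.ι q) = X.ι (conjAct k q) := by
  rw [act_apply, conjAct_eq, X.π_ι, map_mul]

lemma π_act (k : G) (y : X.E) : X.π (X.act k y) = k * X.π y * k⁻¹ := by
  simp [act_apply]

lemma act_mul (k l : G) (y : X.E) : X.act (k * l) y = X.act k (X.act l y) := by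
  rw [X.act_apply l, map_mul, act_ι, act_apply, act_apply, opClass_mul_left, map_mul, mul_assoc]

lemma act_π (x y : X.E) : X.act (X.π x) y = x * y * x⁻¹ := by
  rw [act_apply, ← comm_eq]; group

lemma act_one (y : X.E) : X.act 1 y = y := by simp [act_apply, opClass_one_left]

/-- The action of `G` on an extension by automorphisms. -/
def actHom : G →* MulAut X.E where
  toFun k :=
    { X.act k with
      invFun := X.act k⁻¹
      left_inv := fun y => by
        change X.act k⁻¹ (X.act k y) = y
        rw [← act_mul, inv_mul_cancel, act_one]
      right_inv := fun y => by
        change X.act k (X.act k⁻¹ y) = y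
        rw [← act_mul, mul_inv_cancel, act_one] }
  map_one' := MulEquiv.ext X.act_one
  map_mul' k l := MulEquiv.ext (X.act_mul k l)

lemma actHom_apply (k : G) (y : X.E) : X.actHom k y = X.act k y := rfl

/-! ### Adjoining a lift of one element -/

section Adjoin

variable (g : G)

/-- The semidirect product of an extension with an infinite cyclic group acting as `g`. -/
abbrev Semi : Type u := X.E ⋊[X.actHom.comp (zpowersHom G g)] Multiplicative ℤ

open SemidirectProduct

/-- The element of the semidirect product which identifies the square of the generator of the
cyclic group with the class of `(g)`. -/
def Semi.rel : X.Semi g := inl (X.ι (sqClass g))⁻¹ * inr (Multiplicative.ofAdd 2)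

lemma Semi.inr_conj (y : X.E) :
    (inr (Multiplicative.ofAdd 1) * inl y * (inr (Multiplicative.ofAdd 1))⁻¹ : X.Semi g) =
      inl (X.act g y) := by
  rw [← map_inv, ← inl_aut]
  simp [zpowersHom_apply, actHom_apply]

lemma Semi.ofAdd_two : (Multiplicative.ofAdd 2 : Multiplicative ℤ) =
    Multiplicative.ofAdd 1 * Multiplicative.ofAdd 1 := rfl

lemma Semi.closure_eq (s : Subgroup (X.Semi g)) (h1 : ∀ y, inl y ∈ s)
    (h2 : inr (Multiplicative.ofAdd 1) ∈ s) (x : X.Semi g) : x ∈ s := by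
  rw [← inl_left_mul_inr_right x]
  refine mul_mem (h1 _) ?_
  have : x.right = (Multiplicative.ofAdd 1) ^ (Multiplicative.toAdd x.right) := by
    rw [← ofAdd_zsmul]; simp
  rw [this, map_zpow]
  exact zpow_mem h2 _

/-- The square of the cyclic generator acts as g², which is the value of (g), hence as conjugation
by the class of (g). That class is fixed by g, so the relator also commutes with the generator. -/
lemma Semi.rel_mem_center : Semi.rel X g ∈ Subgroup.center (X.Semi g) := by
  have hι : X.act g (X.ι (sqClass g))⁻¹ = (X.ι (sqClass g))⁻¹ := by
    rw [map_inv, act_ι, conjAct_sqClass]; simp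
  suffices h : ∀ x, x ∈ Subgroup.centralizer {Semi.rel X g} by
    rw [Subgroup.mem_center_iff]
    intro x
    exact ((Subgroup.mem_centralizer_singleton_iff).1 (h x))
  refine Semi.closure_eq X g _ (fun y => ?_) ?_ <;> rw [Subgroup.mem_centralizer_singleton_iff]
  · rw [Semi.rel, Semi.ofAdd_two, map_mul]
    have h := Semi.inr_conj X g y
    have h' := Semi.inr_conj X g (X.act g y)
    rw [← X.act_mul, ← pow_two, ← value_sqClass, ← X.π_ι, act_π, ← h] at h'
    simp only [map_mul, map_inv] at h' ⊢
    rw [mul_inv_eq_iff_eq_mul, ← mul_assoc, mul_inv_eq_iff_eq_mul] at h'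
    rw [mul_assoc _ (_ * _) (inl y), mul_assoc _ _ (inl y), h']
    group
  · have h := Semi.inr_conj X g (X.ι (sqClass g))⁻¹
    rw [hι] at h
    rw [Semi.rel, Semi.ofAdd_two, map_mul]
    rw [mul_inv_eq_iff_eq_mul] at h
    rw [← mul_assoc, h]
    group

instance : (Subgroup.zpowers (Semi.rel X g)).Normal where
  conj_mem n hn k := by
    have h : n ∈ Subgroup.center (X.Semi g) :=
      (Subgroup.zpowers_le.2 (Semi.rel_mem_center X g)) hn
    rwa [Subgroup.mem_center_iff.1 h k, mul_inv_cancel_right]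

/-- The group obtained from an extension by adjoining a lift of `g`. -/
abbrev Adj : Type u := X.Semi g ⧸ Subgroup.zpowers (Semi.rel X g)

/-- The inclusion of the old extension. -/
def Adj.incl : X.E →* X.Adj g := (QuotientGroup.mk' _).comp inl

/-- The adjoined lift of `g`. -/
def Adj.t : X.Adj g := QuotientGroup.mk' _ (inr (Multiplicative.ofAdd 1))

/-- The projection of the semidirect product to `G`. -/
def Semi.proj : X.Semi g →* G :=
  SemidirectProduct.lift X.π (zpowersHom G g) fun k =>
    MonoidHom.ext fun y => X.π_act (g ^ Multiplicative.toAdd k) y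

lemma Semi.proj_inl (y : X.E) : Semi.proj X g (inl y) = X.π y := lift_inl ..

lemma Semi.proj_inr (k : ℤ) : Semi.proj X g (inr (Multiplicative.ofAdd k)) = g ^ k := lift_inr ..

/-- The projection to `G`. -/
def Adj.proj : X.Adj g →* G :=
  QuotientGroup.lift _ (Semi.proj X g) <| (Subgroup.zpowers_le (H := (Semi.proj X g).ker)).2 <| by
    rw [MonoidHom.mem_ker, Semi.rel, map_mul, Semi.proj_inl, Semi.proj_inr]
    simp

@[simp]
lemma Adj.proj_incl (y : X.E) : Adj.proj X g (Adj.incl X g y) = X.π y := Semi.proj_inl X g y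

@[simp]
lemma Adj.proj_t : Adj.proj X g (Adj.t X g) = g :=
  (Semi.proj_inr X g 1).trans (zpow_one g)

lemma Adj.t_conj (y : X.E) :
    Adj.t X g * Adj.incl X g y * (Adj.t X g)⁻¹ = Adj.incl X g (X.act g y) := by
  rw [Adj.incl, MonoidHom.comp_apply, MonoidHom.comp_apply, ← Semi.inr_conj, map_mul, map_mul,
    map_inv]
  rfl

lemma Adj.t_sq : Adj.t X g ^ 2 = Adj.incl X g (X.ι (sqClass g)) := by
  rw [Adj.t, ← map_pow, ← map_pow, Adj.incl, MonoidHom.comp_apply, eq_comm,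
    QuotientGroup.mk'_apply, QuotientGroup.mk'_apply, QuotientGroup.eq]
  rw [← map_inv]
  exact Subgroup.mem_zpowers (Semi.rel X g)

/-- The k-th power of the relator has cyclic component 2k, so only the trivial power lies in the old
extension. -/
lemma Adj.incl_injective : Function.Injective (Adj.incl X g) := by
  rw [injective_iff_map_eq_one]
  intro y hy
  rw [Adj.incl, MonoidHom.comp_apply, QuotientGroup.mk'_apply, QuotientGroup.eq_one_iff] at hy
  obtain ⟨k, hk⟩ := Subgroup.mem_zpowers_iff.1 hy
  have h := congrArg rightHom hk
  rw [map_zpow, rightHom_inl, Semi.rel, map_mul, rightHom_inl, one_mul, rightHom_inr,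
    ← ofAdd_zsmul, ← ofAdd_zero] at h
  have h2 : k • (2 : ℤ) = 0 := Multiplicative.ofAdd.injective h
  have h3 : k = 0 := by simpa using h2
  rw [h3, zpow_zero] at hk
  exact (inl_injective (hk.symm.trans (map_one _).symm))

/-- The adjoined element normalizes the old extension and has its square there, so two cosets
suffice. -/
lemma Adj.eq_incl_or (x : X.Adj g) :
    (∃ y, x = Adj.incl X g y) ∨ ∃ y, x = Adj.t X g * Adj.incl X g y := by
  obtain ⟨x, rfl⟩ := QuotientGroup.mk'_surjective _ x
  have h : QuotientGroup.mk' _ x =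
      Adj.incl X g x.left * Adj.t X g ^ (Multiplicative.toAdd x.right) := by
    conv_lhs => rw [← inl_left_mul_inr_right x]
    have : x.right = (Multiplicative.ofAdd 1) ^ (Multiplicative.toAdd x.right) := by
      rw [← ofAdd_zsmul]; simp
    rw [this, map_mul, map_zpow, map_zpow, ← this]
    rfl
  have h2 (k : ℤ) : Adj.t X g ^ (2 * k) = Adj.incl X g (X.ι (sqClass g) ^ k) := by
    rw [zpow_mul, map_zpow, ← Adj.t_sq]; rfl
  have ht (y : X.E) : Adj.incl X g y * Adj.t X g = Adj.t X g * Adj.incl X g (X.act g⁻¹ y) := by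
    rw [← eq_mul_inv_iff_mul_eq, Adj.t_conj, ← act_mul, mul_inv_cancel, act_one]
  obtain ⟨k, hk | hk⟩ := Int.even_or_odd' (Multiplicative.toAdd x.right)
  · left
    rw [h, hk, h2, ← map_mul]
    exact ⟨_, rfl⟩
  · right
    rw [h, hk, zpow_add, zpow_one, h2, ← mul_assoc, ← map_mul, ht]
    exact ⟨_, rfl⟩

lemma Adj.conj_incl (x : X.Adj g) (q : RelQuotient G) :
    x * Adj.incl X g (X.ι q) * x⁻¹ = Adj.incl X g (X.ι (conjAct (Adj.proj X g x) q)) := by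
  have h (y : X.E) (q : RelQuotient G) : Adj.incl X g y * Adj.incl X g (X.ι q) *
      (Adj.incl X g y)⁻¹ = Adj.incl X g (X.ι (conjAct (X.π y) q)) := by
    rw [← X.conj_ι, map_mul, map_mul, map_inv]
  obtain ⟨y, rfl⟩ | ⟨y, rfl⟩ := Adj.eq_incl_or X g x
  · rw [h, Adj.proj_incl]
  · rw [map_mul, conjAct_mul, Adj.proj_incl, Adj.proj_t, ← X.act_ι, ← Adj.t_conj, ← h]
    group

/-- The extension obtained by adjoining a lift of an element `g` outside the image. -/
def adjoin (hg : g ∉ X.π.range) : SqExtension G where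
  E := X.Adj g
  ι := (Adj.incl X g).comp X.ι
  π := Adj.proj X g
  ι_injective := (Adj.incl_injective X g).comp X.ι_injective
  π_ι q := by simp
  ker_π x hx := by
    obtain ⟨y, rfl⟩ | ⟨y, rfl⟩ := Adj.eq_incl_or X g x
    · obtain ⟨q, rfl⟩ := X.ker_π y (by simpa using hx)
      exact ⟨q, rfl⟩
    -- An element of the new coset over 1 would put g in the old image; this is why the kernel does
    -- not grow.
    · refine absurd ⟨y⁻¹, ?_⟩ hg
      rw [map_mul, Adj.proj_t, Adj.proj_incl] at hx
      rw [map_inv, eq_inv_of_mul_eq_one_left hx]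
  conj_ι := Adj.conj_incl X g
  sq_eq x := by
    have h (y : X.E) : Adj.incl X g y ^ 2 =
        Adj.incl X g (X.ι (sqClass (Adj.proj X g (Adj.incl X g y)))) := by
      rw [← map_pow, X.sq_eq, Adj.proj_incl]
    obtain ⟨y, rfl⟩ | ⟨y, rfl⟩ := Adj.eq_incl_or X g x
    · exact h y
    · refine sq_mul_eq ((Adj.incl X g).comp X.ι) (Adj.proj X g) (Adj.conj_incl X g) ?_ (h y) ?_
      · rw [Adj.t_sq, Adj.proj_t]; rfl
      · rw [Adj.t_conj, act_apply, map_mul, Adj.proj_t, Adj.proj_incl]; rfl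

lemma mem_range_adjoin (hg : g ∉ X.π.range) : g ∈ (X.adjoin g hg).π.range :=
  ⟨Adj.t X g, Adj.proj_t X g⟩

lemma range_le_range_adjoin (hg : g ∉ X.π.range) : X.π.range ≤ (X.adjoin g hg).π.range := by
  rintro _ ⟨y, rfl⟩
  exact ⟨Adj.incl X g y, Adj.proj_incl X g y⟩

end Adjoin

-- A finite group has finitely many subgroups, so some extension has maximal image in G; adjoining a
-- missing element would enlarge that image.
variable (G) in
lemma exists_surjective [Finite G] : ∃ X : SqExtension G, Function.Surjective X.π := by
  obtain ⟨_, ⟨X, rfl⟩, hX⟩ :=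
    (Set.toFinite (Set.range fun X : SqExtension G => X.π.range)).exists_maximal
      ⟨_, SqExtension.base G, rfl⟩
  refine ⟨X, fun g => ?_⟩
  by_contra hg
  exact hg (hX ⟨X.adjoin g hg, rfl⟩ (X.range_le_range_adjoin g hg) (X.mem_range_adjoin g hg))

end SqExtension

end Extension

/-! ### Products of squares and the extension of characters -/

section Squares

lemma squares_le_comap {D D' : Type*} [Group D] [Group D'] (f : D →* D') :
    squares D ≤ (squares D').comap f := by
  refine (Subgroup.closure_le _).2 ?_
  rintro _ ⟨x, rfl⟩
  change f (x ^ 2) ∈ squares D'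
  rw [map_pow]
  exact sq_mem_squares (f x)

instance squares_normal (D : Type*) [Group D] : (squares D).Normal where
  conj_mem _ hn k := squares_le_comap (MulAut.conj k).toMonoidHom hn

lemma map_eq_one_of_mem_squares {D : Type*} [Group D] (χ : D →* Multiplicative F2.{u}) {z : D}
    (hz : z ∈ squares D) : χ z = 1 := by
  have h : squares D ≤ χ.ker := by
    refine (Subgroup.closure_le _).2 ?_
    rintro _ ⟨x, rfl⟩
    rw [SetLike.mem_coe, MonoidHom.mem_ker, map_pow]
    generalize χ x = c
    revert c
    decide
  exact h hz

/-- A homomorphism to `ℤ₂` on a subgroup extends to the group if it is trivial on products of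
squares. -/
lemma exists_extension_of_squares {D : Type*} [Group D] (Z : Subgroup D)
    (φ : Z →* Multiplicative F2.{u}) (h : ∀ z : Z, (z : D) ∈ squares D → φ z = 1) :
    ∃ χ : D →* Multiplicative F2.{u}, ∀ z : Z, χ z = φ z := by
  -- The quotient by the squares is a vector space over the field with two elements. The hypothesis
  -- lets φ descend to the image of `Z`, a subspace, from which a functional extends.
  have hsq (x : D ⧸ squares D) : x ^ 2 = 1 := by
    obtain ⟨x, rfl⟩ := QuotientGroup.mk'_surjective _ x
    rw [← map_pow]
    exact (QuotientGroup.eq_one_iff _).2 (sq_mem_squares x)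
  let _ : CommGroup (D ⧸ squares D) :=
    { (inferInstance : Group (D ⧸ squares D)) with
      mul_comm := fun a b => by
        have hi (x : D ⧸ squares D) : x⁻¹ = x := inv_eq_of_mul_eq_one_left (by rw [← pow_two, hsq])
        rw [← hi (a * b), mul_inv_rev, hi, hi] }
  let _ : Module (ZMod 2) (Additive (D ⧸ squares D)) :=
    AddCommGroup.zmodModule fun x => congrArg Additive.ofMul (hsq x.toMul)
  let f : Z →* D ⧸ squares D := (QuotientGroup.mk' _).comp Z.subtype
  have hle : f.ker ≤ φ.ker := fun z hz => h z ((QuotientGroup.eq_one_iff _).1 hz)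
  let ψ : f.range →* Multiplicative F2.{u} :=
    (QuotientGroup.lift f.ker φ hle).comp
      (QuotientGroup.quotientKerEquivRange f).symm.toMonoidHom
  have hψ (z : Z) : ψ ⟨f z, z, rfl⟩ = φ z := by
    have : (QuotientGroup.quotientKerEquivRange f).symm ⟨f z, z, rfl⟩ = (z : Z ⧸ f.ker) := by
      rw [MulEquiv.symm_apply_eq]; rfl
    change QuotientGroup.lift f.ker φ hle ((QuotientGroup.quotientKerEquivRange f).symm _) = _
    rw [this]
    rfl
  let W : Submodule (ZMod 2) (Additive (D ⧸ squares D)) :=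
    AddSubgroup.toZModSubmodule 2 f.range.toAddSubgroup
  let ψ' : W →+ F2.{u} := MonoidHom.toAdditiveLeft ψ
  obtain ⟨g, hg⟩ := LinearMap.exists_extend (AddMonoidHom.toZModLinearMap 2 ψ')
  refine ⟨(AddMonoidHom.toMultiplicativeRight g.toAddMonoidHom).comp (QuotientGroup.mk' _),
    fun z => ?_⟩
  rw [← hψ z]
  exact LinearMap.congr_fun hg ⟨f z, z, rfl⟩

end Squares

/-! ### Products of squares over commuting and Klein bottle pairs -/

section Pairs

/-- In both cases a² commutes with b, so only the parity of `i` matters. -/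
lemma commute_or_semiconj {P : Type*} [Group P] {a b : P}
    (h : Commute a b ∨ SemiconjBy a b b⁻¹) (i : ℤ) :
    (∀ j : ℤ, Commute (a ^ i) (b ^ j)) ∨ ∀ j : ℤ, SemiconjBy (a ^ i) (b ^ j) (b ^ (-j)) := by
  rcases h with h | h
  · exact Or.inl fun j => h.zpow_zpow i j
  · have h2 : Commute (a ^ 2) b := by
      rw [pow_two]
      have := h.inv_right
      rw [inv_inv] at this
      exact this.mul_left h
    have h1 (j : ℤ) : SemiconjBy a (b ^ j) (b ^ (-j)) := by
      rw [zpow_neg, ← inv_zpow]; exact h.zpow_right j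
    have h3 (k j : ℤ) : Commute (a ^ (2 * k)) (b ^ j) := by
      rw [zpow_mul]; exact Commute.zpow_zpow (by simpa using h2) k j
    obtain ⟨k, rfl | rfl⟩ := Int.even_or_odd' i
    · exact Or.inl (h3 k)
    · refine Or.inr fun j => ?_
      rw [zpow_add, zpow_one]
      exact (h3 k (-j)).semiconjBy.mul_left (h1 j)

lemma exists_zpow_mul_zpow_of_mem_closure {P : Type*} [Group P] {a b : P}
    (h : Commute a b ∨ SemiconjBy a b b⁻¹) {y : P} (hy : y ∈ Subgroup.closure {a, b}) :
    ∃ i j : ℤ, y = a ^ i * b ^ j := by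
  have hb (k i j : ℤ) : ∃ i' j' : ℤ, b ^ k * (a ^ i * b ^ j) = a ^ i' * b ^ j' := by
    rcases commute_or_semiconj h i with h | h
    · exact ⟨i, k + j, by rw [← mul_assoc, ← (h k).eq, mul_assoc, zpow_add]⟩
    · have := (h (-k)).eq
      rw [neg_neg] at this
      exact ⟨i, -k + j, by rw [← mul_assoc, ← this, mul_assoc, zpow_add]⟩
  induction hy using Subgroup.closure_induction_left with
  | one => exact ⟨0, 0, by simp⟩
  | mul_left x hx y _ ih =>
    obtain ⟨i, j, rfl⟩ := ih
    rcases hx with rfl | rfl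
    · exact ⟨1 + i, j, by rw [zpow_add, zpow_one, mul_assoc]⟩
    · simpa using hb 1 i j
  | inv_mul_cancel x hx y _ ih =>
    obtain ⟨i, j, rfl⟩ := ih
    rcases hx with rfl | rfl
    · exact ⟨-1 + i, j, by rw [zpow_add, zpow_neg_one, mul_assoc]⟩
    · simpa using hb (-1) i j

/-- In a central extension in which tori, Klein bottles and projective planes lift, the kernel
contains no nontrivial products of squares of lifts of elements of a group in `Γ₁` or `Γ₂`. -/
lemma eq_one_of_mem_squares {P G : Type*} [Group P] [Group G] (p : P →* G)
    (hp : Function.Surjective p) (hc : ∀ z, p z = 1 → ∀ x, Commute z x)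
    (h1 : ∀ x, (p x) ^ 2 = 1 → x ^ 2 = 1) (h2 : ∀ x y, comm (p x) (p y) = 1 → comm x y = 1)
    (h3 : ∀ x y, ucomm (p x) (p y) = 1 → ucomm x y = 1) {A : Subgroup G}
    (hA : A ∈ Γ₁ G ∪ Γ₂ G) (z : A.comap p) (hz : z ∈ squares (A.comap p))
    (hpz : p z = 1) : (z : P) = 1 := by
  rcases hA with hA | ⟨a₀, b₀, rfl, hab⟩
  · have : squares (A.comap p) ≤ ⊥ := by
      refine (Subgroup.closure_le _).2 ?_
      rintro _ ⟨x, rfl⟩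
      exact Subtype.ext (h1 _ (hA _ x.2))
    exact congrArg Subtype.val (this hz)
  obtain ⟨a, rfl⟩ := hp a₀
  obtain ⟨b, rfl⟩ := hp b₀
  have habP : Commute a b ∨ SemiconjBy a b b⁻¹ := by
    rcases hab with h | h
    · left
      have := h2 a b (by rw [comm, h]; group)
      rwa [comm, mul_inv_eq_one, mul_inv_eq_iff_eq_mul] at this
    · right
      have := h3 a b (by rw [ucomm, h]; group)
      rwa [ucomm, ← eq_inv_iff_mul_eq_one, mul_inv_eq_iff_eq_mul] at this
  have habG : Commute (p a) (p b) ∨ SemiconjBy (p a) (p b) (p b)⁻¹ := hab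
  have hcomm (i j : ℤ) : Commute ((a ^ 2) ^ i) (b ^ j) := by
    rw [← zpow_natCast, ← zpow_mul, mul_comm, zpow_mul, zpow_natCast]
    rcases commute_or_semiconj habP i with h | h
    · exact ((h j).pow_left 2 : _)
    · have h' := h (-j)
      rw [neg_neg] at h'
      have := h'.mul_left (h j)
      rw [← pow_two] at this
      exact this
  -- If aⁱ inverts bʲ, the square loses its b-part, but {bʲ, aⁱ} recovers a²ⁱb²ʲ. In either case
  -- a²ⁱb²ʲ is one square or one Klein bottle word.
  have hform : ∀ i j : ℤ, (a ^ i * b ^ j) ^ 2 = (a ^ 2) ^ i * (b ^ 2) ^ j ∨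
      ((a ^ i * b ^ j) ^ 2 = (a ^ 2) ^ i ∧ ucomm (b ^ j) (a ^ i) = (a ^ 2) ^ i * (b ^ 2) ^ j) := by
    intro i j
    have e (c : P) (k : ℤ) : (c ^ 2) ^ k = c ^ k * c ^ k := by
      rw [← zpow_natCast, ← zpow_mul, mul_comm, zpow_mul, zpow_natCast, pow_two]
    rcases commute_or_semiconj habP i with h | h
    · left
      rw [(h j).mul_pow, e, e, pow_two, pow_two]
    · right
      have h' : b ^ j * a ^ i = a ^ i * b ^ (-j) := by simpa using (h (-j)).eq.symm
      constructor
      · rw [pow_two, mul_assoc, ← mul_assoc (b ^ j), h', e]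
        group
      · rw [ucomm, mul_assoc, ← zpow_neg, ← (h j).eq, mul_assoc, ← mul_assoc (a ^ i), ← e,
          ← mul_assoc, ← (hcomm i j).eq, e b, mul_assoc]
  -- The powers of a² and b² commute, so elements of this shape form a subgroup; it remains to see
  -- that it contains all squares.
  have hsq : ∃ i j : ℤ, (z : P) = (a ^ 2) ^ i * (b ^ 2) ^ j := by
    clear hpz
    have hbb (i j : ℤ) : Commute ((a ^ 2) ^ i) ((b ^ 2) ^ j) := by
      rw [← zpow_natCast b, ← zpow_mul]; exact hcomm _ _
    induction hz using Subgroup.closure_induction with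
    | mem y hy =>
      obtain ⟨x, rfl⟩ := hy
      obtain ⟨i, j, hx⟩ := exists_zpow_mul_zpow_of_mem_closure habG x.2
      -- `x` differs from aⁱbʲ by an element of the kernel, which is central and has trivial square
      -- by `h1`.
      have hk : p ((a ^ i * b ^ j)⁻¹ * x) = 1 := by simp [hx]
      have hxe : (x : P) = (a ^ i * b ^ j) * ((a ^ i * b ^ j)⁻¹ * x) := by group
      have : ((x ^ 2 : (Subgroup.closure {p a, p b}).comap p) : P) = (a ^ i * b ^ j) ^ 2 := by
        rw [Subgroup.coe_pow, hxe, ((hc _ hk _).symm).mul_pow,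
          h1 ((a ^ i * b ^ j)⁻¹ * x) (by rw [hk, one_pow]), mul_one]
      rcases hform i j with h | h
      · exact ⟨i, j, this.trans h⟩
      · exact ⟨i, 0, by rw [this, h.1]; simp⟩
    | one => exact ⟨0, 0, by simp⟩
    | mul x y _ _ hx hy =>
      obtain ⟨i, j, hx⟩ := hx
      obtain ⟨k, l, hy⟩ := hy
      refine ⟨i + k, j + l, ?_⟩
      rw [Subgroup.coe_mul, hx, hy, zpow_add, zpow_add, (hbb k j).symm.mul_mul_mul_comm]
    | inv x _ hx =>
      obtain ⟨i, j, hx⟩ := hx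
      exact ⟨-i, -j, by
        rw [Subgroup.coe_inv, hx, mul_inv_rev, ← zpow_neg, ← zpow_neg, (hbb _ _).eq]⟩
  obtain ⟨i, j, hz⟩ := hsq
  rw [hz] at hpz ⊢
  rcases hform i j with h | h
  · rw [← h] at hpz ⊢
    exact h1 _ (by rwa [map_pow] at hpz)
  · rw [← h.2] at hpz ⊢
    exact h3 _ _ (by simpa [ucomm] using hpz)

end Pairs

/-! ### Universality of (G, G)/N among central extensions -/

section Lift

variable {D G : Type u} [Group D] [Group G] (p : D →* G)

/-- A central extension of `G` with elementary abelian kernel receives a homomorphism from the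
quotient of `(G, G)`, mapping the class of `(p y)` to `y²`. -/
lemma exists_lift_of_central (hp : Function.Surjective p)
    (hc : ∀ z, p z = 1 → ∀ x, Commute z x) (h2 : ∀ z, p z = 1 → z ^ 2 = 1) :
    ∃ Ψ : RelQuotient G →* D, ∀ y, Ψ (sqClass (p y)) = y ^ 2 := by
  have hz {x y : D} (h : p x = p y) : ∃ z, p z = 1 ∧ y = z * x :=
    ⟨y * x⁻¹, by simp [h], by group⟩
  -- Squares do not depend on the lift, the kernel being central of exponent 2. The two commutator
  -- words are products of squares and inherit this; each relation then becomes a word identity in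
  -- chosen lifts.
  have hsq {x y : D} (h : p x = p y) : x ^ 2 = y ^ 2 := by
    obtain ⟨z, hz1, rfl⟩ := hz h
    rw [(hc z hz1 x).mul_pow, h2 z hz1, one_mul]
  have hu (x y : D) : ucomm x y = x ^ 2 * (x⁻¹ * y) ^ 2 := by
    simp only [ucomm, pow_two]; group
  have ho (x y : D) : comm x y = x ^ 2 * (x⁻¹ * y) ^ 2 * (y ^ 2)⁻¹ := by
    simp only [comm, pow_two]; group
  have huc {x x' y y' : D} (h : p x = p x') (h' : p y = p y') : ucomm x y = ucomm x' y' := by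
    rw [hu, hu, hsq h, hsq (x := x⁻¹ * y) (y := x'⁻¹ * y') (by simp [h, h'])]
  have hoc {x x' y y' : D} (h : p x = p x') (h' : p y = p y') : comm x y = comm x' y' := by
    rw [ho, ho, hsq h, hsq h', hsq (x := x⁻¹ * y) (y := x'⁻¹ * y') (by simp [h, h'])]
  let τ := Function.surjInv hp
  have hτ (g : G) : p (τ g) = g := Function.surjInv_eq hp g
  let val : Gen G → D
    | Gen.oriented x y => comm (τ x) (τ y)
    | Gen.unoriented x y => ucomm (τ x) (τ y)
    | Gen.square z => τ z ^ 2
  let F : FreeGroup (Gen G) →* D := FreeGroup.lift val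
  have hFs (x : D) (g : G) (h : p x = g) : F (sq g) = x ^ 2 := by
    rw [← hsq (x := τ g) (by rw [h, hτ])]; simp [F, sq, val]
  have hFu (x y : D) (g h : G) (hx : p x = g) (hy : p y = h) : F (up g h) = ucomm x y := by
    rw [← huc (x := τ g) (y := τ h) (by rw [hx, hτ]) (by rw [hy, hτ])]; simp [F, up, val]
  have hFo (x y : D) (g h : G) (hx : p x = g) (hy : p y = h) : F (op g h) = comm x y := by
    rw [← hoc (x := τ g) (y := τ h) (by rw [hx, hτ]) (by rw [hy, hτ])]; simp [F, op, val]
  have hrel : relSubgroup G ≤ F.ker := by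
    refine Subgroup.normalClosure_le_normal ?_
    rintro w ⟨u, v, h, rfl⟩
    rw [SetLike.mem_coe, MonoidHom.mem_ker, map_mul, map_inv, mul_inv_eq_one]
    cases h with
    | powers x i j =>
      rw [map_mul, hFs (τ x ^ i) _ (by simp [hτ]), hFs (τ x ^ j) _ (by simp [hτ]),
        hFs (τ x ^ (i + j)) _ (by simp [hτ])]
      simp only [pow_two]; group
    | unoriented_mul x y =>
      rw [map_mul, hFu (τ x) (τ x * τ y) _ _ (by simp [hτ]) (by simp [hτ]), hFs (τ x) _ (hτ x),
        hFs (τ y) _ (hτ y)]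
      simp only [ucomm, pow_two]; group
    | oriented_eq x y =>
      rw [map_mul, map_mul, hFo (τ x) (τ y) _ _ (hτ x) (hτ y), hFs (τ x) _ (hτ x),
        hFs (τ x⁻¹ * τ y) _ (by simp [hτ]), hFs (τ y)⁻¹ _ (by simp [hτ]),
        hsq (x := τ x⁻¹ * τ y) (y := (τ x)⁻¹ * τ y) (by simp [hτ])]
      simp only [comm, pow_two]; group
    | mul_left x y z =>
      rw [map_mul, hFo (τ x * τ y) (τ z) _ _ (by simp [hτ]) (hτ z),
        hFu (cj (τ y) (τ x)) (cj (τ z) (τ x)) _ _ (by simp [hτ, cj]) (by simp [hτ, cj]),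
        hFu (τ x) (τ z)⁻¹ _ _ (hτ x) (by simp [hτ])]
      simp only [comm, ucomm, cj]; group
    | oriented_conj x y z =>
      rw [map_mul, hFo (cj (τ y) (τ x)) (cj (τ z) (τ x)) _ _ (by simp [hτ, cj]) (by simp [hτ, cj]),
        hFo (τ x) (comm (τ y) (τ z)) _ _ (hτ x) (by simp [hτ, comm]),
        hFo (τ y) (τ z) _ _ (hτ y) (hτ z)]
      simp only [comm, cj]; group
    | unoriented_conj x y z =>
      rw [map_mul, hFu (cj (τ y) (τ x)) (cj (τ z) (τ x)) _ _ (by simp [hτ, cj]) (by simp [hτ, cj]),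
        hFo (τ x) (ucomm (τ y) (τ z)) _ _ (hτ x) (by simp [hτ, ucomm]),
        hFu (τ y) (τ z) _ _ (hτ y) (hτ z)]
      simp only [comm, ucomm, cj]; group
    | unoriented_inv x y z =>
      rw [map_mul, map_inv,
        hFu (cj (τ y) (τ x)) (cj (τ z) (τ x)) _ _ (by simp [hτ, cj]) (by simp [hτ, cj]),
        hFu (τ x) (ucomm (τ y) (τ z))⁻¹ _ _ (hτ x) (by simp [hτ, ucomm]),
        hFu (τ y) (τ z) _ _ (hτ y) (hτ z)]
      simp only [ucomm, cj]; group
  exact ⟨QuotientGroup.lift _ F hrel, fun y => hFs y _ rfl⟩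

end Lift

/-! ### The central extension of a 2-cocycle -/

section TwistedProduct

variable {H : Type u} [Group H]

/-- The condition for a 2-cocycle with values in `ℤ₂`. -/
def IsTwist (f : H → H → F2.{u}) : Prop :=
  ∀ g h j, f (g * h) j + f g h = f h j + f g (h * j)

lemma IsTwist.one_left {f : H → H → F2.{u}} (hf : IsTwist f) (g : H) : f 1 g = f 1 1 := by
  have := hf 1 1 g
  simpa using this.symm

lemma IsTwist.one_right {f : H → H → F2.{u}} (hf : IsTwist f) (g : H) : f g 1 = f 1 1 := by
  have := hf g 1 1
  simpa using this

/-- The central extension of `H` by `ℤ₂` with a given cocycle. -/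
@[ext]
structure TwistedProduct (f : H → H → F2.{u}) (hf : IsTwist f) : Type u where
  /-- The component in `H`. -/
  fst : H
  /-- The component in `ℤ₂`. -/
  snd : F2.{u}

namespace TwistedProduct

variable {f : H → H → F2.{u}} {hf : IsTwist f}

instance : Mul (TwistedProduct f hf) := ⟨fun x y => ⟨x.fst * y.fst, x.snd + y.snd + f x.fst y.fst⟩⟩

/-- The cocycle is not assumed normalized, which forces the correction by `f 1 1` here and in the
inverse. -/
instance : One (TwistedProduct f hf) := ⟨⟨1, -f 1 1⟩⟩

instance : Inv (TwistedProduct f hf) :=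
  ⟨fun x => ⟨x.fst⁻¹, -x.snd - f x.fst⁻¹ x.fst - f 1 1⟩⟩

@[simp] lemma mul_fst (x y : TwistedProduct f hf) : (x * y).fst = x.fst * y.fst := rfl
@[simp] lemma mul_snd (x y : TwistedProduct f hf) :
    (x * y).snd = x.snd + y.snd + f x.fst y.fst := rfl
@[simp] lemma one_fst : (1 : TwistedProduct f hf).fst = 1 := rfl
@[simp] lemma one_snd : (1 : TwistedProduct f hf).snd = -f 1 1 := rfl
@[simp] lemma inv_fst (x : TwistedProduct f hf) : x⁻¹.fst = x.fst⁻¹ := rfl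
@[simp] lemma inv_snd (x : TwistedProduct f hf) :
    x⁻¹.snd = -x.snd - f x.fst⁻¹ x.fst - f 1 1 := rfl

instance : Group (TwistedProduct f hf) :=
  Group.ofLeftAxioms
    (fun x y z => by
      ext1
      · simp [mul_assoc]
      · have := hf x.fst y.fst z.fst
        simp only [mul_fst, mul_snd]
        linear_combination this)
    (fun x => by
      ext1
      · simp
      · simp only [mul_snd, one_snd, one_fst, hf.one_left]
        ring)
    (fun x => by
      ext1
      · simp
      · simp only [mul_snd, one_snd, inv_fst, inv_snd]
        ring)

/-- The projection of the central extension. -/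
def proj : TwistedProduct f hf →* H where
  toFun := fst
  map_one' := rfl
  map_mul' _ _ := rfl

@[simp] lemma proj_apply (x : TwistedProduct f hf) : proj x = x.fst := rfl

end TwistedProduct

end TwistedProduct

open groupCohomology

/-! ### Cocycles and restriction in degree two -/

section Cocycles

variable {G : Type u} [Group G]

variable (G) in
/-- The 2-cocycles with values in `ℤ₂`. -/
abbrev Cocycles : Submodule F2.{u} (G × G → F2.{u}) := cocycles₂ (Rep.trivial F2.{u} G F2.{u})

/-- The class of a cocycle. -/
noncomputable def cocycleClass : Cocycles G →ₗ[F2.{u}] H2 G :=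
  (H2π (Rep.trivial F2.{u} G F2.{u})).hom

lemma mem_cocycles_iff (f : G × G → F2.{u}) :
    f ∈ Cocycles G ↔ IsTwist fun g h => f (g, h) :=
  mem_cocycles₂_iff (A := Rep.trivial F2.{u} G F2.{u}) f

lemma cocycleClass_surjective : Function.Surjective (cocycleClass (G := G)) := fun x =>
  H2_induction_on x fun f => ⟨f, rfl⟩

lemma cocycleClass_eq_zero_iff (f : Cocycles G) :
    cocycleClass f = 0 ↔ ∃ β : G → F2.{u}, ∀ g h, f.1 (g, h) = β h - β (g * h) + β g := by
  refine (H2π_eq_zero_iff (A := Rep.trivial F2.{u} G F2.{u}) f).trans ⟨?_, ?_⟩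
  · rintro ⟨β, hβ⟩
    exact ⟨β, fun g h => (congrFun hβ (g, h)).symm⟩
  · rintro ⟨β, hβ⟩
    exact ⟨β, funext fun x => (hβ x.1 x.2).symm⟩

lemma restriction_cocycleClass (A : Subgroup G) (f : Cocycles G) (f' : Cocycles A)
    (h : ∀ a b : A, f'.1 (a, b) = f.1 (a, b)) :
    restriction A (cocycleClass f) = cocycleClass f' := by
  have e : mapCocycles₂ (A := Rep.trivial F2.{u} G F2.{u}) (B := Rep.trivial F2.{u} A F2.{u})
      A.subtype (CategoryTheory.CategoryStruct.id (Rep.trivial F2.{u} A F2.{u})) f = f' :=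
    Subtype.ext (funext fun x => (h x.1 x.2).symm)
  rw [← e]
  exact H2π_comp_map_apply (A := Rep.trivial F2.{u} G F2.{u}) (B := Rep.trivial F2.{u} A F2.{u})
      A.subtype (CategoryTheory.CategoryStruct.id (Rep.trivial F2.{u} A F2.{u})) f

instance finite_H2 [Finite G] : Finite (H2 G) :=
  Finite.of_surjective _ (cocycleClass_surjective (G := G))

end Cocycles

/-! ### Transgression from characters of the kernel to cohomology -/

namespace SqExtension

variable {G : Type u} [Group G] (X : SqExtension G) (hX : Function.Surjective X.π)

lemma commute_of_ker {z : X.E} (hz : X.π z = 1) (y : X.E) : Commute z y := by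
  have h := X.comm_eq z y
  rw [hz, opClass_one_left, map_one, mul_inv_eq_one, mul_inv_eq_iff_eq_mul] at h
  exact h

lemma sq_of_ker {z : X.E} (hz : X.π z = 1) : z ^ 2 = 1 := by
  rw [X.sq_eq, hz, sqClass_one, map_one]

/-- Each generator (x) is the square of a lift of x. In particular the kernel of `π` consists of
products of squares. -/
lemma ι_mem_squares (q : RelQuotient G) (hX : Function.Surjective X.π) :
    X.ι q ∈ squares X.E := by
  induction q using RelQuotient.induction with
  | h x =>
    obtain ⟨y, rfl⟩ := hX x
    rw [← X.sq_eq]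
    exact sq_mem_squares y
  | hmul a b ha hb => rw [map_mul]; exact mul_mem ha hb

/-- The chosen section of the projection. -/
noncomputable def sec (g : G) : X.E := Function.surjInv hX g

@[simp]
lemma π_sec (g : G) : X.π (X.sec hX g) = g := Function.surjInv_eq hX g

/-- The factor set of the extension. -/
noncomputable def factor (g h : G) : X.π.ker :=
  ⟨X.sec hX g * X.sec hX h * (X.sec hX (g * h))⁻¹, by simp [MonoidHom.mem_ker]⟩

lemma factor_mul_sec (g h : G) :
    (X.factor hX g h : X.E) * X.sec hX (g * h) = X.sec hX g * X.sec hX h := by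
  simp [factor]

lemma factor_cocycle (g h j : G) :
    X.factor hX (g * h) j * X.factor hX g h = X.factor hX h j * X.factor hX g (h * j) := by
  have hc (m : X.π.ker) (y : X.E) : Commute (m : X.E) y := X.commute_of_ker m.2 y
  apply Subtype.ext
  apply mul_right_cancel (b := X.sec hX (g * h * j))
  push_cast
  calc _ = (X.factor hX g h : X.E) * (X.factor hX (g * h) j * X.sec hX (g * h * j)) := by
        rw [(hc (X.factor hX (g * h) j) _).eq, mul_assoc]
    _ = X.sec hX g * (X.sec hX h * X.sec hX j) := by
        rw [factor_mul_sec, ← mul_assoc, factor_mul_sec, mul_assoc]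
    _ = X.factor hX h j * (X.sec hX g * X.sec hX (h * j)) := by
        rw [← factor_mul_sec X hX h j, ← mul_assoc, ← (hc _ _).eq, mul_assoc]
    _ = _ := by rw [← factor_mul_sec, mul_assoc, mul_assoc g h j]

/-- The cocycle obtained from a character of the kernel. -/
noncomputable def cocycle : Additive (X.π.ker →* Multiplicative F2.{u}) →+ Cocycles G where
  toFun φ := ⟨fun x => (φ.toMul (X.factor hX x.1 x.2)).toAdd, (mem_cocycles_iff _).2 fun g h j => by
    have := congrArg φ.toMul (X.factor_cocycle hX g h j)
    rw [map_mul, map_mul] at this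
    exact this⟩
  map_zero' := rfl
  map_add' _ _ := rfl

/-- The cohomology class obtained from a character of the kernel by transgression. -/
noncomputable def transgression : Additive (X.π.ker →* Multiplicative F2.{u}) →+ H2 G :=
  cocycleClass.toAddMonoidHom.comp (X.cocycle hX)

lemma restriction_transgression_eq_zero_iff (A : Subgroup G)
    (φ : X.π.ker →* Multiplicative F2.{u}) :
    restriction A (X.transgression hX (Additive.ofMul φ)) = 0 ↔
      ∃ β : A → F2.{u}, ∀ g h : A,
        (φ (X.factor hX g h)).toAdd = β h - β (g * h) + β g := by
  let f' : Cocycles A := ⟨fun x => (φ (X.factor hX x.1 x.2)).toAdd, (mem_cocycles_iff _).2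
    fun g h j => (mem_cocycles_iff _).1 (X.cocycle hX (Additive.ofMul φ)).2 g h j⟩
  have h := restriction_cocycleClass A (X.cocycle hX (Additive.ofMul φ)) f' fun _ _ => rfl
  rw [transgression, AddMonoidHom.comp_apply]
  exact (Eq.congr_left h).trans (cocycleClass_eq_zero_iff f')

/-- The restriction of the transgression of a character to a subgroup `A` vanishes if and only if
the character is trivial on the products of squares of lifts of elements of `A`. -/
lemma restriction_transgression_eq_zero_iff_squares (A : Subgroup G)
    (φ : X.π.ker →* Multiplicative F2.{u}) :
    restriction A (X.transgression hX (Additive.ofMul φ)) = 0 ↔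
      ∀ z : A.comap X.π, z ∈ squares (A.comap X.π) → ∀ h : X.π z = 1, φ ⟨z, h⟩ = 1 := by
  rw [restriction_transgression_eq_zero_iff]
  constructor
  · rintro ⟨β, hβ⟩ z hz hz1
    let r (y : A.comap X.π) : X.π.ker := ⟨y * (X.sec hX (X.π y))⁻¹, by simp [MonoidHom.mem_ker]⟩
    let b (y : A.comap X.π) : A := ⟨X.π y, y.2⟩
    have hr (y y' : A.comap X.π) : r (y * y') = r y * r y' * X.factor hX (X.π y) (X.π y') := by
      apply Subtype.ext
      have hc (m : X.π.ker) (y : X.E) : Commute (m : X.E) y := X.commute_of_ker m.2 y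
      have e (y : A.comap X.π) : (y : X.E) = r y * X.sec hX (X.π y) := by simp [r]
      have h1 : (r (y * y') : X.E) = y * y' * (X.sec hX (X.π y * X.π y'))⁻¹ := by simp [r]
      rw [h1, mul_inv_eq_iff_eq_mul]
      calc (y : X.E) * y' = r y * X.sec hX (X.π y) * (r y' * X.sec hX (X.π y')) := by
            rw [← e, ← e]
        _ = r y * r y' * (X.sec hX (X.π y) * X.sec hX (X.π y')) :=
            (hc _ _).symm.mul_mul_mul_comm _ _
        _ = _ := by
            rw [Subgroup.coe_mul, Subgroup.coe_mul, mul_assoc _ (X.factor hX _ _ : X.E),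
              factor_mul_sec]
    -- `r` is the kernel part of an element relative to the section. It fails to be multiplicative
    -- by the factor set, and adding β compensates for this after applying φ. The resulting
    -- character must kill products of squares.
    let χ : A.comap X.π →* Multiplicative F2.{u} := MonoidHom.mk'
      (fun y => φ (r y) * Multiplicative.ofAdd (β (b y))) fun y y' => by
        have h : (φ (X.factor hX (X.π y) (X.π y'))).toAdd = _ := hβ (b y) (b y')
        apply Multiplicative.toAdd.injective
        simp only [hr, map_mul, toAdd_mul, h, toAdd_ofAdd]
        rw [show b (y * y') = b y * b y' from Subtype.ext (map_mul _ _ _)]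
        abel
    have h1 := map_eq_one_of_mem_squares χ hz
    -- The section need not send 1 to 1: z is `r z` times the lift of 1, which is the factor at (1,
    -- 1), with φ-value `β 1`.
    have h2 : X.factor hX 1 1 * r z = ⟨z, hz1⟩ := by
      apply Subtype.ext
      simp only [factor, r, hz1, Subgroup.coe_mul, mul_one, mul_inv_cancel_right]
      rw [(X.commute_of_ker hz1 _).eq, mul_inv_cancel_left]
    have h3 : (φ (X.factor hX 1 1)).toAdd = _ := hβ 1 1
    rw [mul_one, sub_self, zero_add] at h3
    rw [← h2, map_mul, mul_comm, ← h1]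
    change φ (r z) * _ = φ (r z) * Multiplicative.ofAdd (β (b z))
    rw [show b z = 1 from Subtype.ext hz1, ← h3, ofAdd_toAdd]
  · intro h
    -- Once φ extends to a character of the whole preimage of `A`, its values on the section form
    -- the required cochain.
    obtain ⟨χ, hχ⟩ := exists_extension_of_squares (X.π.ker.subgroupOf (A.comap X.π))
      (φ.comp ((A.comap X.π).subtype.subgroupComap X.π.ker)) fun z hz => h z hz z.2
    let σ (a : A) : A.comap X.π := ⟨X.sec hX a, by simp⟩
    refine ⟨fun a => (χ (σ a)).toAdd, fun g h => ?_⟩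
    have hm : ((X.factor hX g h : X.E)) ∈ A.comap X.π := by
      rw [Subgroup.mem_comap, (X.factor hX g h).2]; exact one_mem A
    have h1 : (⟨_, hm⟩ : A.comap X.π) * σ (g * h) = σ g * σ h :=
      Subtype.ext (X.factor_mul_sec hX g h)
    have h2 : χ ⟨_, hm⟩ = φ (X.factor hX g h) := hχ ⟨⟨_, hm⟩, (X.factor hX g h).2⟩
    have h3 := congrArg (fun x => (χ x).toAdd) h1
    simp only [map_mul, h2, toAdd_mul] at h3
    rw [eq_sub_of_add_eq h3]
    abel

/-- For the whole of G the vanishing criterion covers every kernel element, since all of them are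
products of squares. -/
lemma transgression_injective : Function.Injective (X.transgression hX) := by
  rw [injective_iff_map_eq_zero]
  intro φ hφ
  have h := (X.restriction_transgression_eq_zero_iff_squares hX ⊤ φ.toMul).1
    (by rw [ofMul_toMul, hφ, map_zero])
  refine MonoidHom.ext fun m => ?_
  obtain ⟨q, hq⟩ := X.ker_π m m.2
  let j : X.E →* (⊤ : Subgroup G).comap X.π := MonoidHom.mk' (fun y => ⟨y, trivial⟩) fun _ _ => rfl
  exact h (j m) (squares_le_comap j (hq ▸ X.ι_mem_squares q hX)) m.2

/-- The inflated cocycle is shown to be trivial on E: its extension D of E has a character that is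
the identity on ℤ₂. Restricting that character to a copy of the kernel of `π` gives the preimage. -/
lemma transgression_surjective : Function.Surjective (X.transgression hX) := by
  intro x
  obtain ⟨f, rfl⟩ := cocycleClass_surjective x
  have hf := (mem_cocycles_iff _).1 f.2
  have hf' : IsTwist fun y y' : X.E => f.1 (X.π y, X.π y') := fun y y' y'' => by
    simpa using hf (X.π y) (X.π y') (X.π y'')
  let p : TwistedProduct _ hf' →* G := X.π.comp TwistedProduct.proj
  have h2 (a : F2.{u}) : a + a = 0 := by revert a; decide
  have hp : Function.Surjective p := fun g => ⟨⟨X.sec hX g, 0⟩, by simp [p]⟩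
  have hpz {z : TwistedProduct _ hf'} (hz : p z = 1) : X.π z.fst = 1 := hz
  obtain ⟨Ψ, hΨ⟩ := exists_lift_of_central p hp
    (fun z hz y => by
      ext1
      · exact X.commute_of_ker hz _
      · simp only [TwistedProduct.mul_snd, hpz hz, hf.one_left, hf.one_right, add_comm z.snd])
    (fun z hz => by
      ext1
      · rw [pow_two]
        simpa [pow_two] using X.sq_of_ker hz
      · rw [pow_two, TwistedProduct.mul_snd, hpz hz, TwistedProduct.one_snd, h2, zero_add,
          map_one, eq_neg_iff_add_eq_zero, h2])
  let proj : TwistedProduct _ hf' →* X.E := TwistedProduct.proj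
  have hΨι (q : RelQuotient G) : proj (Ψ q) = X.ι q := by
    have : proj.comp Ψ = X.ι := RelQuotient.hom_ext fun g => by
      obtain ⟨y, rfl⟩ := hp g
      rw [MonoidHom.comp_apply, hΨ, map_pow, X.sq_eq]
      rfl
    exact DFunLike.congr_fun this q
  -- `Ψ` lifts the injective `ι`, so its range, and with it every product of squares, meets the
  -- kernel of D → E only in 1.
  have hsq : squares (TwistedProduct _ hf') ≤ Ψ.range := by
    refine (Subgroup.closure_le _).2 ?_
    rintro _ ⟨y, rfl⟩
    exact ⟨_, hΨ y⟩
  -- The shift by f(1, 1) is needed because the identity of D has second coordinate -f(1, 1).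
  let κ : proj.ker →* Multiplicative F2.{u} := MonoidHom.mk'
    (fun z => Multiplicative.ofAdd ((z : TwistedProduct _ hf').snd + f.1 (1, 1))) fun z z' => by
      have hz (z : proj.ker) : (z : TwistedProduct _ hf').fst = 1 := z.2
      rw [← ofAdd_add, Subgroup.coe_mul, TwistedProduct.mul_snd, hz, hz, map_one]
      congr 1
      abel
  obtain ⟨χ, hχ⟩ := exists_extension_of_squares proj.ker κ fun z hz => by
    obtain ⟨q, hq⟩ := hsq hz
    have h1 : q = 1 := X.ι_injective (by rw [← hΨι, hq, map_one]; exact z.2)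
    have h3 : z = 1 := Subtype.ext (by rw [← hq, h1, map_one]; rfl)
    rw [h3, map_one]
  -- Over the kernel of `π` the inflated cocycle is the constant f(1, 1), so D splits there.
  let i : X.π.ker →* TwistedProduct _ hf' :=
    MonoidHom.mk' (fun m => ⟨m, -f.1 (1, 1)⟩) fun m m' => by
    have hm (m : X.π.ker) : X.π m = 1 := m.2
    ext1
    · rfl
    · simp [hm]
  refine ⟨Additive.ofMul (χ.comp i), ?_⟩
  rw [transgression, AddMonoidHom.comp_apply, ← sub_eq_zero]
  change cocycleClass _ - cocycleClass _ = 0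
  rw [← map_sub, cocycleClass_eq_zero_iff]
  -- Comparing products of the lifts `(sec g, 0)` in D produces both the factor set of E and the
  -- value of f; applying χ turns this into the coboundary equation.
  refine ⟨fun g => (χ ⟨X.sec hX g, 0⟩).toAdd, fun g h => ?_⟩
  let z : proj.ker := ⟨⟨1, f.1 (g, h) - f.1 (1, 1)⟩, rfl⟩
  have hz : χ z = Multiplicative.ofAdd (f.1 (g, h)) := by
    rw [hχ]; simp [κ, z]
  have hm : X.π (X.factor hX g h) = 1 := (X.factor hX g h).2
  have e : (⟨X.sec hX g, 0⟩ * ⟨X.sec hX h, 0⟩ : TwistedProduct _ hf') =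
      i (X.factor hX g h) * ⟨X.sec hX (g * h), 0⟩ * z := by
    ext1
    · simp [i, z, factor_mul_sec]
    · have h1 := hf.one_left (g * h)
      have h3 := hf.one_right (g * h)
      simp [i, z, hm, h1, h3]
  have h3 := congrArg (fun x => (χ x).toAdd) e
  simp only [map_mul, hz, toAdd_mul, toAdd_ofAdd] at h3
  have h4 := h2 (f.1 (g, h))
  change (χ (i (X.factor hX g h))).toAdd - f.1 (g, h) = _
  linear_combination (-1 : F2.{u}) * h3 - h4

/-! ### The multiplier as the kernel, extendable classes and characters of B₀ -/

lemma ucomm_eq (x y : X.E) : ucomm x y = X.ι (pr (up (X.π x) (X.π y))) := by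
  have h : ucomm x y = x ^ 2 * (x⁻¹ * y) ^ 2 := by
    simp only [ucomm, pow_two]; group
  rw [h, X.sq_eq, X.sq_eq, pr_up, ← map_mul, map_mul X.π, map_inv]
  rfl

lemma π_ι_pr (w : FreeGroup (Gen G)) : X.π (X.ι (pr w)) = canonicalMap G w := by
  rw [X.π_ι, value_pr]

/-- The unoriented Schur multiplier maps to the kernel of the extension. -/
def multiplierHom : SchurMultiplier G →* X.π.ker :=
  QuotientGroup.lift _
    (MonoidHom.mk' (fun w : (canonicalMap G).ker => (⟨X.ι (pr w), by
      rw [MonoidHom.mem_ker, π_ι_pr, w.2, Subgroup.coe_one]⟩ : X.π.ker)) fun a b =>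
        Subtype.ext (by simp)) fun w hw => Subtype.ext (by
          have : pr (w : FreeGroup (Gen G)) = 1 := (QuotientGroup.eq_one_iff _).2 hw
          change X.ι (pr w) = 1
          rw [this, map_one])

lemma multiplierHom_mk (w : (canonicalMap G).ker) :
    (X.multiplierHom (QuotientGroup.mk w) : X.E) = X.ι (pr w) := rfl

lemma multiplierHom_bijective : Function.Bijective X.multiplierHom := by
  constructor
  · rw [injective_iff_map_eq_one]
    intro m hm
    obtain ⟨w, rfl⟩ := QuotientGroup.mk_surjective m
    have h : X.ι (pr w) = X.ι 1 := by
      rw [← multiplierHom_mk, hm, map_one, Subgroup.coe_one]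
    exact (QuotientGroup.eq_one_iff _).2
      ((QuotientGroup.eq_one_iff (N := relSubgroup G) _).1 (X.ι_injective h))
  · rintro ⟨m, hm⟩
    obtain ⟨q, rfl⟩ := X.ker_π m hm
    obtain ⟨w, rfl⟩ := QuotientGroup.mk'_surjective _ q
    have hw : w ∈ (canonicalMap G).ker := Subtype.ext ((X.π_ι_pr w).symm.trans hm)
    exact ⟨QuotientGroup.mk ⟨w, hw⟩, rfl⟩

/-- The unoriented Schur multiplier is isomorphic to the kernel of the extension. -/
noncomputable def multiplierEquiv : SchurMultiplier G ≃* X.π.ker :=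
  MulEquiv.ofBijective _ X.multiplierHom_bijective

/-- The transgression of a character restricts trivially to the groups in `Γ₁` and `Γ₂` if and only
if the character is trivial on the extendable classes. -/
lemma restriction_transgression_eq_zero_iff_extendable (φ : X.π.ker →* Multiplicative F2.{u}) :
    (∀ A ∈ Γ₁ G ∪ Γ₂ G, restriction A (X.transgression hX (Additive.ofMul φ)) = 0) ↔
      extendableSubgroup G ≤ (φ.comp X.multiplierHom).ker := by
  simp only [restriction_transgression_eq_zero_iff_squares]
  constructor
  · intro h
    have key (A : Subgroup G) (hA : A ∈ Γ₁ G ∪ Γ₂ G) (z : A.comap X.π)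
        (hz : z ∈ squares (A.comap X.π)) (w : (canonicalMap G).ker)
        (hw : (z : X.E) = X.ι (pr w)) : φ (X.multiplierHom (QuotientGroup.mk w)) = 1 := by
      have hz1 : X.π z = 1 := by rw [hw, π_ι_pr, w.2, Subgroup.coe_one]
      rw [← h A hA z hz hz1]
      exact congrArg φ (Subtype.ext (by rw [multiplierHom_mk, ← hw]))
    refine (Subgroup.closure_le _).2 ?_
    rintro _ ⟨w, rfl, ⟨x, y, hxy, hw⟩ | ⟨x, y, hxy, hw⟩ | ⟨x, hx, hw⟩⟩
    · have hx : x ∈ Subgroup.closure {x, y} := Subgroup.subset_closure (by simp)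
      have hy : y ∈ Subgroup.closure {x, y} := Subgroup.subset_closure (by simp)
      refine key (Subgroup.closure {x, y}) (Or.inr ⟨x, y, rfl, Or.inl ?_⟩) _
        (comm_mem_squares ⟨X.sec hX x, by simpa⟩ ⟨X.sec hX y, by simpa⟩) w ?_
      · rwa [comm, mul_inv_eq_one, mul_inv_eq_iff_eq_mul] at hxy
      · exact (X.comm_eq _ _).trans (by rw [hw, π_sec, π_sec]; rfl)
    · have hx : x ∈ Subgroup.closure {x, y} := Subgroup.subset_closure (by simp)
      have hy : y ∈ Subgroup.closure {x, y} := Subgroup.subset_closure (by simp)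
      refine key (Subgroup.closure {x, y}) (Or.inr ⟨x, y, rfl, Or.inr ?_⟩) _
        (ucomm_mem_squares ⟨X.sec hX x, by simpa⟩ ⟨X.sec hX y, by simpa⟩) w ?_
      · rwa [ucomm, ← eq_inv_iff_mul_eq_one, mul_inv_eq_iff_eq_mul] at hxy
      · exact (X.ucomm_eq _ _).trans (by rw [hw, π_sec, π_sec])
    -- For a projective plane the cyclic group of order at most 2 generated by x already lies in Γ₁.
    · refine key (Subgroup.zpowers x) (Or.inl ?_) _
        (sq_mem_squares ⟨X.sec hX x, by simp⟩) w ?_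
      · rintro _ ⟨k, rfl⟩
        change (x ^ k) ^ 2 = 1
        rw [← zpow_natCast, zpow_comm, zpow_natCast, hx, one_zpow]
      · exact (X.sq_eq _).trans (by rw [hw, π_sec]; rfl)
  · intro h A hA z hz hz1
    -- Dividing E by the kernel of φ kills the extendable classes, so squares and both commutator
    -- words are trivial upstairs whenever they are in G, as `eq_one_of_mem_squares` requires.
    let K : Subgroup X.E := φ.ker.map X.π.ker.subtype
    have hK : K ≤ X.π.ker := by
      rintro _ ⟨m, _, rfl⟩
      exact m.2
    have : K.Normal := ⟨fun n hn g => by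
      rwa [← (X.commute_of_ker (hK hn) g).eq, mul_inv_cancel_right]⟩
    let p : X.E ⧸ K →* G := QuotientGroup.lift K X.π hK
    have hmk (w : FreeGroup (Gen G)) (hw : w ∈ (canonicalMap G).ker)
        (hm : (QuotientGroup.mk ⟨w, hw⟩ : SchurMultiplier G) ∈ extendableSubgroup G) :
        X.ι (pr w) ∈ K := ⟨_, h hm, rfl⟩
    have hker (w : FreeGroup (Gen G)) (x : X.E) (hx : x = X.ι (pr w)) (hx1 : X.π x = 1) :
        w ∈ (canonicalMap G).ker := by
      rw [hx, π_ι_pr] at hx1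
      exact Subtype.ext hx1
    have hp (x : X.E) : p (QuotientGroup.mk' K x) = X.π x := rfl
    have := eq_one_of_mem_squares p
      (fun g => ⟨QuotientGroup.mk' K (X.sec hX g), by rw [hp, π_sec]⟩)
      (fun z hz x => by
        obtain ⟨z, rfl⟩ := QuotientGroup.mk'_surjective _ z
        obtain ⟨x, rfl⟩ := QuotientGroup.mk'_surjective _ x
        exact (X.commute_of_ker hz x).map _)
      (fun x hx => by
        obtain ⟨x, rfl⟩ := QuotientGroup.mk'_surjective _ x
        rw [hp] at hx
        rw [← map_pow]
        have e : x ^ 2 = X.ι (pr (sq (X.π x))) := X.sq_eq x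
        refine (QuotientGroup.eq_one_iff _).2 (e ▸ hmk _ (hker _ _ e (by rw [map_pow, hx]))
          (Subgroup.subset_closure ⟨_, rfl, Or.inr (Or.inr ⟨_, hx, rfl⟩)⟩)))
      (fun x y hx => by
        obtain ⟨x, rfl⟩ := QuotientGroup.mk'_surjective _ x
        obtain ⟨y, rfl⟩ := QuotientGroup.mk'_surjective _ y
        rw [hp, hp] at hx
        have e : comm x y = X.ι (pr (op (X.π x) (X.π y))) := X.comm_eq x y
        refine (QuotientGroup.eq_one_iff (comm x y)).2 (e ▸ hmk _ (hker _ _ e ?_)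
          (Subgroup.subset_closure ⟨_, rfl, Or.inl ⟨_, _, hx, rfl⟩⟩))
        rw [← hx]; simp [comm])
      (fun x y hx => by
        obtain ⟨x, rfl⟩ := QuotientGroup.mk'_surjective _ x
        obtain ⟨y, rfl⟩ := QuotientGroup.mk'_surjective _ y
        rw [hp, hp] at hx
        have e : ucomm x y = X.ι (pr (up (X.π x) (X.π y))) := X.ucomm_eq x y
        refine (QuotientGroup.eq_one_iff (ucomm x y)).2 (e ▸ hmk _ (hker _ _ e ?_)
          (Subgroup.subset_closure ⟨_, rfl, Or.inr (Or.inl ⟨_, _, hx, rfl⟩)⟩))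
        rw [← hx]; simp [ucomm])
      hA (MonoidHom.mk' (fun y : A.comap X.π => (⟨QuotientGroup.mk' K y, y.2⟩ : A.comap p))
        (fun _ _ => rfl) z) (squares_le_comap _ hz) hz1
    obtain ⟨m, hm, hmz⟩ := (QuotientGroup.eq_one_iff (z : X.E)).1 this
    rw [← show m = ⟨z, hz1⟩ from Subtype.ext hmz]
    exact hm

lemma schurMultiplier_sq (X : SqExtension G) (m : SchurMultiplier G) : m ^ 2 = 1 := by
  apply X.multiplierHom_bijective.1
  rw [map_pow, map_one]
  exact Subtype.ext (X.sq_of_ker (X.multiplierHom m).2)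

/-- Characters of the unoriented Bogomolov multiplier as characters of the kernel. -/
noncomputable def inflate :
    Additive (BogomolovMultiplier G →* Multiplicative F2.{u}) →+
      Additive (X.π.ker →* Multiplicative F2.{u}) where
  toFun χ := Additive.ofMul
    ((χ.toMul.comp (QuotientGroup.mk' _)).comp X.multiplierEquiv.symm.toMonoidHom)
  map_zero' := rfl
  map_add' _ _ := rfl

lemma inflate_injective : Function.Injective X.inflate := by
  intro χ χ' h
  refine MonoidHom.ext fun b => ?_
  obtain ⟨m, rfl⟩ := QuotientGroup.mk'_surjective _ b
  have := DFunLike.congr_fun (F := X.π.ker →* Multiplicative F2.{u}) h (X.multiplierEquiv m)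
  change χ.toMul (QuotientGroup.mk' _ (X.multiplierEquiv.symm (X.multiplierEquiv m))) =
    χ'.toMul (QuotientGroup.mk' _ (X.multiplierEquiv.symm (X.multiplierEquiv m))) at this
  rwa [X.multiplierEquiv.symm_apply_apply] at this

lemma mem_range_inflate_iff (φ : X.π.ker →* Multiplicative F2.{u}) :
    (∃ χ, X.inflate χ = Additive.ofMul φ) ↔
      extendableSubgroup G ≤ (φ.comp X.multiplierHom).ker := by
  constructor
  · rintro ⟨χ, hχ⟩ m hm
    have : φ = (χ.toMul.comp (QuotientGroup.mk' _)).comp X.multiplierEquiv.symm.toMonoidHom :=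
      hχ.symm
    have e : X.multiplierEquiv.symm (X.multiplierHom m) = m :=
      X.multiplierEquiv.symm_apply_apply m
    have h1 : (QuotientGroup.mk' (extendableSubgroup G)) m = 1 := (QuotientGroup.eq_one_iff m).2 hm
    rw [MonoidHom.mem_ker, this]
    change χ.toMul (QuotientGroup.mk' _ (X.multiplierEquiv.symm (X.multiplierHom m))) = 1
    rw [e, h1, map_one]
  · intro h
    refine ⟨Additive.ofMul (QuotientGroup.lift _ (φ.comp X.multiplierHom) h), ?_⟩
    refine MonoidHom.ext fun m => ?_
    exact congrArg φ (X.multiplierEquiv.apply_symm_apply m)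

/-- Characters of the unoriented Bogomolov multiplier are the cohomology classes which restrict
trivially to the groups in `Γ₁` and `Γ₂`. -/
noncomputable def characterEquiv :
    Additive (BogomolovMultiplier G →* Multiplicative F2.{u}) ≃+
      ↥(⨅ A ∈ Γ₁ G ∪ Γ₂ G, LinearMap.ker (restriction A)) :=
  have hmem (φ : X.π.ker →* Multiplicative F2.{u}) :
      X.transgression hX (Additive.ofMul φ) ∈
        ⨅ A ∈ Γ₁ G ∪ Γ₂ G, LinearMap.ker (restriction A) ↔
      ∃ χ, X.inflate χ = Additive.ofMul φ := by
    rw [mem_range_inflate_iff, ← X.restriction_transgression_eq_zero_iff_extendable hX]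
    simp only [Submodule.mem_iInf, LinearMap.mem_ker]
  AddEquiv.ofBijective
    (((X.transgression hX).comp X.inflate).codRestrict _ fun χ => (hmem _).2 ⟨χ, rfl⟩)
    ⟨fun χ χ' h => X.inflate_injective (X.transgression_injective hX (congrArg Subtype.val h)),
      fun ⟨x, hx⟩ => by
        obtain ⟨φ, rfl⟩ := X.transgression_surjective hX x
        obtain ⟨χ, hχ⟩ := (hmem φ.toMul).1 hx
        exact ⟨χ, Subtype.ext (congrArg (X.transgression hX) hχ)⟩⟩

end SqExtension

/-- An elementary abelian 2-group with finitely many characters is isomorphic to its group of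
characters. -/
lemma nonempty_mulEquiv_characters {B : Type*} [Group B] (hc : ∀ a b : B, a * b = b * a)
    (h2 : ∀ a : B, a ^ 2 = 1) [Finite (B →* Multiplicative F2.{u})] :
    Nonempty (B ≃* (B →* Multiplicative F2.{u})) := by
  let _ : CommGroup B := { (inferInstance : Group B) with mul_comm := hc }
  let _ : Module (ZMod 2) (Additive B) :=
    AddCommGroup.zmodModule fun x => congrArg Additive.ofMul (h2 x.toMul)
  let e : Module.Dual (ZMod 2) (Additive B) ≃+ Additive (B →* Multiplicative F2.{u}) :=
    { toFun := fun f => Additive.ofMul (AddMonoidHom.toMultiplicativeRight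
        (AddEquiv.ulift.symm.toAddMonoidHom.comp f.toAddMonoidHom))
      invFun := fun χ => AddMonoidHom.toZModLinearMap 2
        (AddEquiv.ulift.toAddMonoidHom.comp (MonoidHom.toAdditiveLeft χ.toMul))
      left_inv := fun _ => rfl
      right_inv := fun _ => rfl
      map_add' := fun _ _ => rfl }
  have : Finite (Module.Dual (ZMod 2) (Additive B)) := Finite.of_equiv _ e.symm.toEquiv
  -- Finiteness of the dual bounds the dimension, so a basis identifies the space with its dual.
  have : Module.Finite (ZMod 2) (Additive B) :=
    (Module.finite_dual_iff (ZMod 2)).1 inferInstance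
  exact ⟨AddEquiv.toMultiplicative
    ((Module.finBasis (ZMod 2) (Additive B)).toDualEquiv.toAddEquiv.trans e)⟩

end UnorientedBogomolov

theorem mainTheorem10 (G : Type*) [Group G] [Finite G] :
    Nonempty (UnorientedBogomolov.BogomolovMultiplier G ≃*
      Multiplicative ↥(⨅ A ∈ UnorientedBogomolov.Γ₁ G ∪ UnorientedBogomolov.Γ₂ G,
        LinearMap.ker (UnorientedBogomolov.restriction A))) := by
  obtain ⟨X, hX⟩ := UnorientedBogomolov.SqExtension.exists_surjective G
  have e := X.characterEquiv hX
  -- The characters correspond to a subspace of H²(G; ℤ₂), which is finite because there are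
  -- finitely many cocycles.
  have : Finite (UnorientedBogomolov.BogomolovMultiplier G →*
      Multiplicative UnorientedBogomolov.F2) := Finite.of_equiv _ e.symm.toEquiv
  have hc (a b : UnorientedBogomolov.BogomolovMultiplier G) : a * b = b * a := by
    obtain ⟨a, rfl⟩ := QuotientGroup.mk'_surjective _ a
    obtain ⟨b, rfl⟩ := QuotientGroup.mk'_surjective _ b
    rw [← map_mul, UnorientedBogomolov.schurMultiplier_mul_comm, map_mul]
  have h2 (a : UnorientedBogomolov.BogomolovMultiplier G) : a ^ 2 = 1 := by
    obtain ⟨a, rfl⟩ := QuotientGroup.mk'_surjective _ a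
    rw [← map_pow, X.schurMultiplier_sq, map_one]
  obtain ⟨e'⟩ := UnorientedBogomolov.nonempty_mulEquiv_characters hc h2
  exact ⟨e'.trans (AddEquiv.toMultiplicativeRight e)⟩
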